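/- Let $G=(V,E_V)$ be a locally finite connected graph with graph distance $\rho$, and write $B(x,r)=\{y\in V:\rho(x,y)\le r\}$. Let $\mu$ be a measure on $V$ whose point masses $\mu_x=\mu(\{x\})$ satisfy $c_M^{-1}\le\mu_x\le c_M$ for all $x\in V$, and suppose that for some $d>0$, $c_G\ge 1$ and $r_G\in[1,\infty]$, $$c_G^{-1}r^d\le\mu(B(x,r))\le c_Gr^d\qquad\text{for all }x\in V,\ 1\le r<r_G .$$ Let $\alpha\in(0,2)$, and let $\{w_{x,y}\}_{x,y\in V}$ satisfy $w_{x,x}=0$, $w_{x,y}=w_{y,x}\ge0$ and $\sum_{y\in V}w_{x,y}\rho(x,y)^{-d-\alpha}\mu_y<\infty$ for every $x\in V$ (with the convention $0/0=0$). Put $B^w(x,r)=\{z\in B(x,r):w_{x,z}>0\}$. For $x_0\in V$ and $R\ge1$ set $\hat w_{x,y}=w_{x,y}$ if $x\in B(x_0,R)$ or $y\in B(x_0,R)$, and $\hat w_{x,y}=1$ otherwise. Let $\hat X^{R,R}=((\hat X^{R,R}_t)_{t\ge0},(\mathbb P_x)_{x\in V})$ be the continuous-time Markov process on $V$ (the localized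 truncated process) with generator $$\hat L^{R,R}f(x)=\sum_{y\in V:\,\rho(x,y)\le R}(f(y)-f(x))\,\frac{\hat w_{x,y}}{\rho(x,y)^{d+\alpha}}\,\mu_y,$$ so that $\mathbb P_x(\hat X^{R,R}_0=x)=1$; write $\mathbb E_x$ for the expectation under $\mathbb P_x$. Fix $x_0\in V$. Suppose that there exist $1\le R_0<r_G$, $\theta\in(0,1)$ and constants $C_1,C_2>0$ such that for every $R_0<R<r_G$ and $R^\theta\le r\le R$, $$\sup_{x\in B(x_0,3R)}\ \sum_{y:\rho(x,y)\le r}\frac{w_{x,y}}{\rho(x,y)^{d+\alpha-2}}\le C_1r^{2-\alpha},\qquad \inf_{x\in B(x_0,3R)}\mu(B^w(x,r))\ge C_2r^d,\qquad \sup_{x\in B(x_0,3R)}\ \sum_{y\in B^w(x,r)}w_{x,y}^{-1}\le C_1r^d .$$ Then for every $\theta'\in(\theta,1)$ there is a constant $R_1>R_0$, depending only on $\theta$, $\theta'$ and $R_0$, such that for every $R_1<R<r_G$ and $x\in V$, $$\mathbb E_x\big[\rho(\hat X^{R,R}_t,x)\big]\le C_3R\Big(\frac t{R^\alpha}\Big)^{1/2}\Big[1+\log\Big(\frac{R^\alpha}t\Big)\Big]\qquad\text{for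 all }R^{\theta'\alpha}\le t\le R^\alpha,$$ where $C_3>0$ depends only on $d,\alpha,c_M,c_G,C_1,C_2,\theta,\theta'$; in particular it does not depend on the graph, the conductances, $x_0$, $R_0$, $R_1$, $R$, $t$, $x$ or $r_G$. -/

import Mathlib

namespace StableLike

/-- The closed ball `B(x, r) = {y : ρ(x, y) ≤ r}` of the graph distance `ρ = G.dist`. -/
def ball {V : Type*} (G : SimpleGraph V) (x : V) (r : ℝ) : Set V :=
  {y | (G.dist x y : ℝ) ≤ r}

/-- The mass `μ(A) = ∑_{y ∈ A} μ_y` of the measure on `V` with point masses `μ_y`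
(only used for finite sets `A`). -/
noncomputable def mass {V : Type*} (μ : V → ℝ) (A : Set V) : ℝ :=
  ∑' y : A, μ y

/-- `B^w(x, r) = {z ∈ B(x, r) : w_{x,z} > 0}`. -/
def posBall {V : Type*} (G : SimpleGraph V) (w : V → V → ℝ) (x : V) (r : ℝ) : Set V :=
  {z | z ∈ ball G x r ∧ 0 < w x z}

/-- `(G, μ)` is a locally finite connected graph with a measure whose point masses lie in
`[c_M⁻¹, c_M]`, and it satisfies the `d`-set condition
`c_G⁻¹ r ^ d ≤ μ(B(x, r)) ≤ c_G r ^ d` for all `x` and `1 ≤ r < r_G`, where `r_G ∈ [1, ∞]`. -/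
structure IsDSetGraph {V : Type*} (G : SimpleGraph V) (μ : V → ℝ) (d cM cG : ℝ)
    (rG : EReal) : Prop where
  locallyFinite : ∀ x, (G.neighborSet x).Finite
  connected : G.Connected
  le_mass_point : ∀ x, cM⁻¹ ≤ μ x
  mass_point_le : ∀ x, μ x ≤ cM
  one_le_rG : 1 ≤ rG
  le_mass_ball : ∀ (x : V) (r : ℝ), 1 ≤ r → (r : EReal) < rG →
    cG⁻¹ * r ^ d ≤ mass μ (ball G x r)
  mass_ball_le : ∀ (x : V) (r : ℝ), 1 ≤ r → (r : EReal) < rG →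
    mass μ (ball G x r) ≤ cG * r ^ d

/-- `w` is a symmetric nonnegative family, vanishing on the diagonal, such that
`∑_y w_{x,y} ρ(x, y) ^ (-(d + α)) μ_y < ∞` for every `x`.
The diagonal term is `0 / 0 = 0`. -/
structure IsConductance {V : Type*} (G : SimpleGraph V) (μ : V → ℝ) (d α : ℝ)
    (w : V → V → ℝ) : Prop where
  diag : ∀ x, w x x = 0
  nonneg : ∀ x y, 0 ≤ w x y
  symm : ∀ x y, w x y = w y x
  summable : ∀ x, Summable fun y => w x y / (G.dist x y : ℝ) ^ (d + α) * μ y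

/-- The three bounds on the conductances at scale `r`, for all centres in `B(x₀, 3R)`. -/
structure ScaleBounds {V : Type*} (G : SimpleGraph V) (μ : V → ℝ) (d α : ℝ)
    (w : V → V → ℝ) (x₀ : V) (C₁ C₂ R r : ℝ) : Prop where
  second_moment : ∀ x ∈ ball G x₀ (3 * R),
    ∑' y : ball G x r, w x y / (G.dist x y : ℝ) ^ (d + α - 2) ≤ C₁ * r ^ (2 - α)
  mass_posBall : ∀ x ∈ ball G x₀ (3 * R), C₂ * r ^ d ≤ mass μ (posBall G w x r)
  inverse_sum : ∀ x ∈ ball G x₀ (3 * R),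
    ∑' y : posBall G w x r, (w x y)⁻¹ ≤ C₁ * r ^ d

open Classical in
/-- The localized conductances: `ŵ_{x,y} = w_{x,y}` if `x` or `y` lies in `B(x₀, R)`, and
`ŵ_{x,y} = 1` otherwise. -/
noncomputable def localized {V : Type*} (G : SimpleGraph V) (w : V → V → ℝ) (x₀ : V)
    (R : ℝ) (x y : V) : ℝ :=
  if x ∈ ball G x₀ R ∨ y ∈ ball G x₀ R then w x y else 1

/-- The generator of the process with conductances `w`, truncated at jumps of length `R`:
`f ↦ ∑_{z : ρ(x,z) ≤ R} (f(z) - f(x)) w_{x,z} ρ(x,z) ^ (-(d + α)) μ_z`. -/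
noncomputable def truncatedGenerator {V : Type*} (G : SimpleGraph V) (μ : V → ℝ)
    (d α R : ℝ) (w : V → V → ℝ) (f : V → ℝ) (x : V) : ℝ :=
  ∑' z : ball G x R, (f z - f x) * (w x z / (G.dist x z : ℝ) ^ (d + α)) * μ z

/-- `X` is, under `P`, the continuous-time Markov process on the discrete space `V` with
generator `L`, started at `x`: its paths are right-continuous with left limits, it is adapted
to the filtration `𝓕`, and it solves the martingale problem for `L` with the finitely supported
functions as test functions. -/
structure IsJumpProcess {V Ω : Type*} [mΩ : MeasurableSpace Ω] (L : (V → ℝ) → V → ℝ) (x : V)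
    (P : MeasureTheory.Measure Ω) (𝓕 : MeasureTheory.Filtration NNReal mΩ)
    (X : NNReal → Ω → V) : Prop where
  adapted : ∀ t y, @MeasurableSet Ω (𝓕 t) {ω | X t ω = y}
  right_continuous : ∀ ω t, ∀ᶠ s in nhdsWithin t (Set.Ioi t), X s ω = X t ω
  left_limits : ∀ ω t, 0 < t → ∃ y, ∀ᶠ s in nhdsWithin t (Set.Iio t), X s ω = y
  initial : ∀ᵐ ω ∂P, X 0 ω = x
  martingale : ∀ f : V → ℝ, (Function.support f).Finite →
    MeasureTheory.Martingale
      (fun (t : NNReal) ω =>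
        f (X t ω) - f (X 0 ω) - ∫ s in (0 : ℝ)..t, L f (X s.toNNReal ω)) 𝓕 P

end StableLike

namespace StableLike

open Set Filter Topology

/-! The proof is Nash's entropy method, run with information only at scales `r ≥ R ^ θ`. Let `p s`
be the density of the process started at `x`, `E` its Dirichlet energy, `M` its mean distance from
`x`, and `Q = -∑ μ p log p` its entropy.

Outside `B(x₀, 3R)` the localized conductances equal one on every edge of length at most `R`, so the
three scale bounds hold, with modified constants, around every vertex. Comparing `p` at `y` with its
average over the neighbours `z ∈ B(y, r)` of positive conductance, by Cauchy-Schwarz with weights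
`ŵ` and `ŵ⁻¹`, gives `‖p‖² ≤ A r ^ α E + A r ^ (-d)` for `R ^ θ ≤ r ≤ R` (`mul_sq_le_average`).
Taking `r` of order `s ^ (1 / α)` yields `‖p s‖² ≤ C s ^ (-d / α) (t / s) ^ m` for all `0 < s ≤ t`
(`decay_of_nash`). The factor `(t / s) ^ m` pays for the times below order `R ^ (θ α)`, where only
the trivial bound is known; it is affordable because `t ≥ R ^ (θ' α)` with `θ' > θ`.

The decay bounds `Q` from below (`entropy_lower`). The derivative of `M` is controlled by the
product of the second moment of the jumps, `D` of order `R ^ (2 - α)`, and the entropy production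
`Q'`. The arithmetic-geometric mean inequality with weight `κ / √s`, integrated by parts in time,
gives `M(t) ≤ 2 κ D √t + √t / (2 κ) (Q(t) - (d / α) log t + const)` (`mean_le_entropy`), in which
the powers of `t / s` have become a constant. Volume growth bounds `Q(t)` above by `b M(t) / n + d
log n + const` (`entropy_upper`, `exp_growth`).

With `n` of order `R ^ (1 - α / 2) √t = R (t / R ^ α) ^ (1 / 2)` and `κ` of order `R ^ (-(1 - α /
2))`, the term in `M(t)` on the right is at most `M(t) / 2` and is absorbed, while `d log n - (d /
α) log t` becomes a multiple of `log (R ^ α / t)` (`diffusive_bound`). The entropy is regularised by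
`ε` and the distance truncated at `N` so that all sums converge and may be differentiated termwise.
-/

/-- `p` is the density, with respect to the point masses `μ`, of the law of the symmetric jump
process with edge weights `k` started at `x`; the jump rates are bounded by `lam` and the point
masses are bounded below by `c⁻¹`. -/
structure HeatFlow {V : Type*} (μ : V → ℝ) (k : V → V → ℝ) (c lam : ℝ) (x : V)
    (p : ℝ → V → ℝ) : Prop where
  c_pos : 0 < c
  inv_le : ∀ y, c⁻¹ ≤ μ y
  k_symm : ∀ y z, k y z = k z y
  k_nonneg : ∀ y z, 0 ≤ k y z
  k_summable : ∀ y, Summable (k y)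
  k_tsum_le : ∀ y, ∑' z, k y z ≤ lam * μ y
  nonneg : ∀ t, 0 ≤ t → ∀ y, 0 ≤ p t y
  hasSum : ∀ t, 0 ≤ t → HasSum (fun y => μ y * p t y) 1
  cont : ∀ y, ContinuousOn (fun t => p t y) (Ici 0)
  deriv : ∀ y t, 0 < t →
    HasDerivAt (fun s => p s y) ((μ y)⁻¹ * ∑' z, k y z * (p t z - p t y)) t
  initial : ∀ y, y ≠ x → p 0 y = 0

/-! ### Differentiating sums of functions of the density along the flow. -/

namespace HeatFlow

variable {V : Type*} {μ : V → ℝ} {k : V → V → ℝ} {c lam : ℝ} {x : V} {p : ℝ → V → ℝ}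

lemma mass_pos (h : HeatFlow μ k c lam x p) (y : V) : 0 < μ y :=
  (inv_pos.2 h.c_pos).trans_le (h.inv_le y)

lemma lam_nonneg (h : HeatFlow μ k c lam x p) : 0 ≤ lam := by
  have h1 := (tsum_nonneg (h.k_nonneg x)).trans (h.k_tsum_le x)
  exact nonneg_of_mul_nonneg_left h1 (h.mass_pos x)

lemma mul_nonneg' (h : HeatFlow μ k c lam x p) {t : ℝ} (ht : 0 ≤ t) (y : V) :
    0 ≤ μ y * p t y := mul_nonneg (h.mass_pos y).le (h.nonneg t ht y)

lemma le_c (h : HeatFlow μ k c lam x p) {t : ℝ} (ht : 0 ≤ t) (y : V) : p t y ≤ c := by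
  have h1 : μ y * p t y ≤ 1 :=
    le_hasSum (h.hasSum t ht) y fun z _ => h.mul_nonneg' ht z
  have h2 := h.inv_le y
  have h3 := h.nonneg t ht y
  have h4 : c⁻¹ * p t y ≤ 1 := (mul_le_mul_of_nonneg_right h2 h3).trans h1
  rwa [inv_mul_le_iff₀ h.c_pos, mul_one] at h4

lemma summable_mul (h : HeatFlow μ k c lam x p) {t : ℝ} (ht : 0 ≤ t) (y : V) :
    Summable fun z => k y z * p t z :=
  ((h.k_summable y).mul_right c).of_nonneg_of_le
    (fun z => mul_nonneg (h.k_nonneg y z) (h.nonneg t ht z))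
    fun z => mul_le_mul_of_nonneg_left (h.le_c ht z) (h.k_nonneg y z)

lemma tsum_flow (h : HeatFlow μ k c lam x p) {t : ℝ} (ht : 0 ≤ t) (y : V) :
    ∑' z, k y z * (p t z - p t y) = ∑' z, k y z * p t z - (∑' z, k y z) * p t y := by
  simp_rw [mul_sub]
  rw [(h.summable_mul ht y).tsum_sub ((h.k_summable y).mul_right _), tsum_mul_right]

/-- Mass leaves a vertex at rate at most `lam` and the incoming flow is nonnegative. Consequently
all densities up to time `T` are dominated by a multiple of the one at time `T`: a summable
majorant, uniform in time, which justifies termwise limits. This is the only role of `lam`, which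
enters no final constant. -/
lemma exp_mul_monotoneOn (h : HeatFlow μ k c lam x p) (y : V) :
    MonotoneOn (fun t => Real.exp (lam * t) * p t y) (Ici 0) := by
  have hd : ∀ t, 0 < t → HasDerivAt (fun t => Real.exp (lam * t) * p t y)
      (Real.exp (lam * t) * (lam * 1) * p t y +
        Real.exp (lam * t) * ((μ y)⁻¹ * ∑' z, k y z * (p t z - p t y))) t := fun t ht =>
    (((hasDerivAt_id t).const_mul lam).exp).mul (h.deriv y t ht)
  refine monotoneOn_of_deriv_nonneg (convex_Ici 0) ?_ ?_ ?_
  · exact (Continuous.continuousOn (by fun_prop)).mul (h.cont y)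
  · intro t ht
    rw [interior_Ici] at ht
    exact (hd t ht).differentiableAt.differentiableWithinAt
  · intro t ht
    rw [interior_Ici] at ht
    rw [(hd t ht).deriv, h.tsum_flow (le_of_lt ht), mul_one, mul_assoc, ← mul_add]
    refine mul_nonneg (Real.exp_pos _).le ?_
    have h1 : 0 ≤ ∑' z, k y z * p t z := tsum_nonneg fun z =>
      mul_nonneg (h.k_nonneg y z) (h.nonneg t (le_of_lt ht) z)
    have h2 := mul_le_mul_of_nonneg_right (h.k_tsum_le y) (h.nonneg t (le_of_lt ht) y)
    have h3 := h.mass_pos y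
    have h4 : lam * p t y + (μ y)⁻¹ * (∑' z, k y z * p t z - (∑' z, k y z) * p t y) =
      (μ y)⁻¹ * (∑' z, k y z * p t z + (lam * μ y * p t y - (∑' z, k y z) * p t y)) := by
      field_simp; ring
    rw [h4]
    exact mul_nonneg (inv_pos.2 h3).le (by linarith)

lemma le_exp_mul (h : HeatFlow μ k c lam x p) {t T : ℝ} (ht : 0 ≤ t) (hT : t ≤ T) (y : V) :
    p t y ≤ Real.exp (lam * T) * p T y := by
  have h1 := h.exp_mul_monotoneOn y (mem_Ici.2 ht) (mem_Ici.2 (ht.trans hT)) hT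
  have h2 : 1 ≤ Real.exp (lam * t) := Real.one_le_exp (mul_nonneg h.lam_nonneg ht)
  exact (le_mul_of_one_le_left (h.nonneg t ht y) h2).trans h1

lemma summable_fst (h : HeatFlow μ k c lam x p) {t : ℝ} (ht : 0 ≤ t) :
    Summable fun q : V × V => k q.1 q.2 * p t q.1 := by
  rw [summable_prod_of_nonneg fun q => mul_nonneg (h.k_nonneg _ _) (h.nonneg t ht _)]
  refine ⟨fun y => (h.k_summable y).mul_right (p t y), ?_⟩
  refine ((h.hasSum t ht).summable.mul_left lam).of_nonneg_of_le
    (fun y => tsum_nonneg fun z => mul_nonneg (h.k_nonneg _ _) (h.nonneg t ht _)) fun y => ?_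
  dsimp only
  rw [tsum_mul_right, ← mul_assoc]
  exact mul_le_mul_of_nonneg_right (h.k_tsum_le y) (h.nonneg t ht y)

lemma summable_snd (h : HeatFlow μ k c lam x p) {t : ℝ} (ht : 0 ≤ t) :
    Summable fun q : V × V => k q.1 q.2 * p t q.2 := by
  have := (Equiv.prodComm V V).summable_iff.2 (h.summable_fst ht)
  refine this.congr fun q => ?_
  simp [h.k_symm q.2 q.1]

lemma summable_bdd_mul (h : HeatFlow μ k c lam x p) {t : ℝ} (ht : 0 ≤ t) {B : ℝ}
    {f : V × V → ℝ} (hf : ∀ q, |f q| ≤ B * (p t q.1 + p t q.2)) :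
    Summable fun q : V × V => k q.1 q.2 * f q := by
  refine Summable.of_norm_bounded
    (((h.summable_fst ht).add (h.summable_snd ht)).mul_left B) fun q => ?_
  rw [Real.norm_eq_abs, abs_mul, abs_of_nonneg (h.k_nonneg _ _)]
  refine (mul_le_mul_of_nonneg_left (hf q) (h.k_nonneg _ _)).trans (le_of_eq (by ring))

lemma abs_sub_le (h : HeatFlow μ k c lam x p) {t : ℝ} (ht : 0 ≤ t) (y z : V) :
    |p t y - p t z| ≤ p t y + p t z := by
  have h1 := h.nonneg t ht y
  have h2 := h.nonneg t ht z
  rw [abs_le]; constructor <;> linarith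

/-- Summation by parts for the generator. -/
lemma sum_by_parts (h : HeatFlow μ k c lam x p) {t : ℝ} (ht : 0 ≤ t) {B : ℝ} {f : V → ℝ}
    (hf : ∀ y, |f y| ≤ B) :
    ∑' y, f y * ∑' z, k y z * (p t z - p t y) =
      -(1 / 2) * ∑' q : V × V, k q.1 q.2 * ((f q.1 - f q.2) * (p t q.1 - p t q.2)) := by
  have s1 : Summable fun q : V × V => k q.1 q.2 * (f q.1 * (p t q.2 - p t q.1)) := by
    refine h.summable_bdd_mul ht (B := B) fun q => ?_
    rw [abs_mul, abs_sub_comm]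
    exact mul_le_mul (hf _) (h.abs_sub_le ht _ _) (abs_nonneg _) ((abs_nonneg _).trans (hf q.1))
  have s2 : Summable fun q : V × V => k q.1 q.2 * (f q.2 * (p t q.1 - p t q.2)) := by
    refine h.summable_bdd_mul ht (B := B) fun q => ?_
    rw [abs_mul]
    exact mul_le_mul (hf _) (h.abs_sub_le ht _ _) (abs_nonneg _) ((abs_nonneg _).trans (hf q.1))
  have e1 : ∑' y, f y * ∑' z, k y z * (p t z - p t y) =
      ∑' q : V × V, k q.1 q.2 * (f q.1 * (p t q.2 - p t q.1)) := by
    rw [s1.tsum_prod]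
    refine tsum_congr fun y => ?_
    rw [← tsum_mul_left]
    exact tsum_congr fun z => by ring
  have e2 : ∑' q : V × V, k q.1 q.2 * (f q.1 * (p t q.2 - p t q.1)) =
      ∑' q : V × V, k q.1 q.2 * (f q.2 * (p t q.1 - p t q.2)) := by
    rw [← (Equiv.prodComm V V).tsum_eq]
    refine tsum_congr fun q => ?_
    simp [h.k_symm q.2 q.1]
  have e3 := s1.tsum_add s2
  rw [← e2] at e3
  have e4 : ∑' q : V × V, k q.1 q.2 * ((f q.1 - f q.2) * (p t q.1 - p t q.2)) =
      - ∑' q : V × V, (k q.1 q.2 * (f q.1 * (p t q.2 - p t q.1)) +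
        k q.1 q.2 * (f q.2 * (p t q.1 - p t q.2))) := by
    rw [← tsum_neg]
    exact tsum_congr fun q => by ring
  rw [e1, e4, e3]; ring

lemma abs_le_mul_of_hasDerivAt {Φ φ : ℝ → ℝ} {B c a : ℝ} (h0 : Φ 0 = 0)
    (hd : ∀ a, 0 ≤ a → HasDerivAt Φ (φ a) a) (hB : ∀ a, 0 ≤ a → a ≤ c → |φ a| ≤ B)
    (ha : 0 ≤ a) (hac : a ≤ c) : |Φ a| ≤ B * a := by
  have := Convex.norm_image_sub_le_of_norm_hasDerivWithin_le (f := Φ) (f' := φ) (s := Icc 0 a)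
    (x := 0) (y := a) (C := B) (fun b hb => (hd b hb.1).hasDerivWithinAt)
    (fun b hb => hB b hb.1 (hb.2.trans hac)) (convex_Icc 0 a) ⟨le_rfl, ha⟩ ⟨ha, le_rfl⟩
  simpa [h0, abs_of_nonneg ha] using this

variable {Φ φ : V → ℝ → ℝ} {B : ℝ}

lemma summable_functional (h : HeatFlow μ k c lam x p) (h0 : ∀ y, Φ y 0 = 0)
    (hd : ∀ y a, 0 ≤ a → HasDerivAt (Φ y) (φ y a) a)
    (hB : ∀ y a, 0 ≤ a → a ≤ c → |φ y a| ≤ B) {t : ℝ} (ht : 0 ≤ t) :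
    Summable fun y => μ y * Φ y (p t y) := by
  refine Summable.of_norm_bounded ((h.hasSum t ht).summable.mul_left B) fun y => ?_
  rw [Real.norm_eq_abs, abs_mul, abs_of_pos (h.mass_pos y)]
  have := abs_le_mul_of_hasDerivAt (h0 y) (hd y) (hB y) (h.nonneg t ht y) (h.le_c ht y)
  exact (mul_le_mul_of_nonneg_left this (h.mass_pos y).le).trans (le_of_eq (by ring))

lemma continuousOn_functional (h : HeatFlow μ k c lam x p) (h0 : ∀ y, Φ y 0 = 0)
    (hd : ∀ y a, 0 ≤ a → HasDerivAt (Φ y) (φ y a) a)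
    (hB : ∀ y a, 0 ≤ a → a ≤ c → |φ y a| ≤ B) :
    ContinuousOn (fun t => ∑' y, μ y * Φ y (p t y)) (Ici 0) := by
  intro t ht
  have hT : (0 : ℝ) ≤ t + 1 := by have : (0 : ℝ) ≤ t := ht; linarith
  have hc : ContinuousOn (fun t => ∑' y, μ y * Φ y (p t y)) (Icc 0 (t + 1)) := by
    refine continuousOn_tsum (u := fun y =>
      B * Real.exp (lam * (t + 1)) * (μ y * p (t + 1) y)) ?_ ?_ ?_
    · intro y
      refine continuousOn_const.mul fun s hs => ?_
      exact ((hd y _ (h.nonneg s hs.1 y)).continuousAt).comp_continuousWithinAt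
        (f := fun t => p t y) (((h.cont y) s hs.1).mono Icc_subset_Ici_self)
    · exact (h.hasSum _ hT).summable.mul_left _
    · intro y s hs
      rw [Real.norm_eq_abs, abs_mul, abs_of_pos (h.mass_pos y)]
      have h1 := abs_le_mul_of_hasDerivAt (h0 y) (hd y) (hB y) (h.nonneg s hs.1 y)
        (h.le_c hs.1 y)
      have hB0 : 0 ≤ B := (abs_nonneg _).trans (hB y 0 le_rfl h.c_pos.le)
      have h2 := mul_le_mul_of_nonneg_left (h.le_exp_mul hs.1 hs.2 y) hB0
      refine (mul_le_mul_of_nonneg_left (h1.trans h2) (h.mass_pos y).le).trans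
        (le_of_eq (by ring))
  refine (hc t ⟨ht, by linarith⟩).mono_of_mem_nhdsWithin ?_
  rw [mem_nhdsWithin]
  exact ⟨Iio (t + 1), isOpen_Iio, by simp, fun s hs => ⟨hs.2, hs.1.le⟩⟩

/-- The common source of three derivatives: of the `L²` norm (`Φ = a²`), of the entropy, and of the
mean of a bounded function (`Φ` linear in `a`). -/
lemma hasDerivAt_functional (h : HeatFlow μ k c lam x p) (h0 : ∀ y, Φ y 0 = 0)
    (hd : ∀ y a, 0 ≤ a → HasDerivAt (Φ y) (φ y a) a)
    (hB : ∀ y a, 0 ≤ a → a ≤ c → |φ y a| ≤ B) {t : ℝ} (ht : 0 < t) :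
    HasDerivAt (fun t => ∑' y, μ y * Φ y (p t y))
      (-(1 / 2) * ∑' q : V × V, k q.1 q.2 *
        ((φ q.1 (p t q.1) - φ q.2 (p t q.2)) * (p t q.1 - p t q.2))) t := by
  have hT : (0 : ℝ) ≤ t + 1 := by linarith
  set E := Real.exp (lam * (t + 1)) with hE
  have hE0 : 0 < E := Real.exp_pos _
  have hB0 : ∀ y : V, 0 ≤ B := fun y => (abs_nonneg _).trans (hB y 0 le_rfl h.c_pos.le)
  -- Inflow and outflow are bounded separately on `(0, t + 1)`, each by `exp (lam (t + 1))` times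
  -- its bound at time `t + 1`.
  have key := hasDerivAt_tsum_of_isPreconnected (𝕜 := ℝ) (F := ℝ)
    (u := fun y => B * (E * (∑' z, k y z * p (t + 1) z) + E * (lam * (μ y * p (t + 1) y))))
    (g := fun y s => μ y * Φ y (p s y))
    (g' := fun y s => μ y * (φ y (p s y) * ((μ y)⁻¹ * ∑' z, k y z * (p s z - p s y))))
    (t := Ioo 0 (t + 1)) (y₀ := t) (y := t) ?_ isOpen_Ioo isPreconnected_Ioo ?_ ?_
    ⟨ht, by linarith⟩ (h.summable_functional h0 hd hB ht.le) ⟨ht, by linarith⟩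
  · refine key.congr_deriv ?_
    rw [← h.sum_by_parts ht.le (B := B) (f := fun y => φ y (p t y))
      fun y => hB y _ (h.nonneg t ht.le y) (h.le_c ht.le y)]
    refine tsum_congr fun y => ?_
    have := (h.mass_pos y).ne'
    field_simp
  · refine Summable.mul_left _ (Summable.add ?_ ?_)
    · exact (h.summable_snd hT).prod.mul_left _
    · exact ((h.hasSum _ hT).summable.mul_left _).mul_left _
  · intro y s hs
    exact ((hd y _ (h.nonneg s hs.1.le y)).comp s (h.deriv y s hs.1)).const_mul _
  · intro y s hs
    have hμ := h.mass_pos y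
    have e : μ y * (φ y (p s y) * ((μ y)⁻¹ * ∑' z, k y z * (p s z - p s y))) =
        φ y (p s y) * ∑' z, k y z * (p s z - p s y) := by field_simp
    rw [e, Real.norm_eq_abs, abs_mul]
    refine mul_le_mul (hB y _ (h.nonneg s hs.1.le y) (h.le_c hs.1.le y)) ?_ (abs_nonneg _)
      (hB0 y)
    rw [h.tsum_flow hs.1.le]
    have h1 : 0 ≤ ∑' z, k y z * p s z := tsum_nonneg fun z =>
      mul_nonneg (h.k_nonneg y z) (h.nonneg s hs.1.le z)
    have h2 : ∑' z, k y z * p s z ≤ E * ∑' z, k y z * p (t + 1) z := by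
      rw [← tsum_mul_left]
      refine (h.summable_mul hs.1.le y).tsum_le_tsum (fun z => ?_)
        ((h.summable_mul hT y).mul_left _)
      refine (mul_le_mul_of_nonneg_left (h.le_exp_mul hs.1.le hs.2.le z)
        (h.k_nonneg y z)).trans (le_of_eq (by rw [hE]; ring))
    have h3 : 0 ≤ (∑' z, k y z) * p s y :=
      mul_nonneg (tsum_nonneg (h.k_nonneg y)) (h.nonneg s hs.1.le y)
    have h4 : (∑' z, k y z) * p s y ≤ E * (lam * (μ y * p (t + 1) y)) := by
      refine (mul_le_mul (h.k_tsum_le y) (h.le_exp_mul hs.1.le hs.2.le y)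
        (h.nonneg s hs.1.le y) (mul_nonneg h.lam_nonneg hμ.le)).trans (le_of_eq ?_)
      rw [hE]; ring
    rw [abs_le]; constructor <;> linarith

end HeatFlow

/-! ### Decay of the `L²` norm from a Nash inequality at restricted scales. -/

/-- Decay of a function satisfying the Nash-type differential inequality at all scales
`r ∈ [R ^ θ, R]`. -/
lemma decay_of_nash {d α θ θ' A c : ℝ} (hd : 0 < d) (hα : 0 < α) (hθ : 0 < θ) (hθθ' : θ < θ')
    (hc : 0 < c) (hA : 0 < A) (hA1 : 1 ≤ A * (d / α)) :
    ∃ C : ℝ, 0 < C ∧ ∀ (R : ℝ) (u E : ℝ → ℝ), 1 ≤ R → ContinuousOn u (Ici 0) →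
      (∀ s, 0 ≤ s → u s ≤ c) → (∀ s, 0 < s → HasDerivAt u (-E s) s) →
      (∀ s, 0 < s → ∀ r, R ^ θ ≤ r → r ≤ R → u s ≤ A * r ^ α * E s + A * r ^ (-d)) →
      ∀ t, R ^ (θ' * α) ≤ t → t ≤ R ^ α → ∀ s, 0 < s → s ≤ t →
        s ^ (d / α + θ * (d / α) / (θ' - θ)) * u s ≤ C * t ^ (θ * (d / α) / (θ' - θ)) := by
  have hβ : 0 < d / α := div_pos hd hα
  set β := d / α with hβd
  have hθ'' : 0 < θ' - θ := sub_pos.2 hθθ'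
  have hm : 0 < θ * β / (θ' - θ) := div_pos (mul_pos hθ hβ) hθ''
  set m := θ * β / (θ' - θ) with hmd
  -- This identity dictates `m`: it turns `(R ^ (θ α)) ^ (β + m)` into `(R ^ (θ' α)) ^ m`, which is
  -- at most `t ^ m`.
  have hmθ : θ * (β + m) = θ' * m := by rw [hmd]; field_simp; ring
  set k := β + m with hk
  have hk0 : 0 < k := by positivity
  have hkA0 : 0 < k * A := by positivity
  -- Needed so that the radius chosen below does not exceed `R`.
  have hkA : 1 ≤ k * A := by nlinarith
  set K := k * A * (k * A) ^ β / m with hK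
  have hK0 : 0 < K := by positivity
  refine ⟨K + (k * A) ^ k * c, by positivity, ?_⟩
  intro R u E hR hu huc hder hnash t ht htR s hs hst
  have hR0 : 0 < R := by linarith
  -- The time at which the optimal radius equals `R ^ θ`. Up to `τ₀` only `u ≤ c` is used;
  -- afterwards the differential inequality takes over.
  set τ₀ := k * A * R ^ (θ * α) with hτ₀
  have hτ₀0 : 0 < τ₀ := by positivity
  have hτk : τ₀ ^ k ≤ (k * A) ^ k * t ^ m := by
    rw [hτ₀, Real.mul_rpow hkA0.le (by positivity), ← Real.rpow_mul hR0.le,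
      show θ * α * k = θ' * α * m by rw [mul_right_comm, hmθ]; ring, Real.rpow_mul hR0.le]
    refine mul_le_mul_of_nonneg_left ?_ (by positivity)
    exact Real.rpow_le_rpow (by positivity) ht hm.le
  have hstm : s ^ m ≤ t ^ m := Real.rpow_le_rpow hs.le hst hm.le
  have htm : 0 < t ^ m := Real.rpow_pos_of_pos (hs.trans_le hst) m
  rcases le_or_gt s τ₀ with hsτ | hsτ
  · have h1 : s ^ k * u s ≤ s ^ k * c :=
      mul_le_mul_of_nonneg_left (huc s hs.le) (by positivity)
    have h2 : s ^ k ≤ τ₀ ^ k := Real.rpow_le_rpow hs.le hsτ hk0.le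
    have h3 : s ^ k * c ≤ (k * A) ^ k * t ^ m * c :=
      mul_le_mul_of_nonneg_right (h2.trans hτk) hc.le
    nlinarith [mul_pos hK0 htm]
  · have hanti : AntitoneOn (fun τ => τ ^ k * u τ - K * τ ^ m) (Icc τ₀ s) := by
      have hdv : ∀ τ, 0 < τ → HasDerivAt (fun τ => τ ^ k * u τ - K * τ ^ m)
          (k * τ ^ (k - 1) * u τ + τ ^ k * (-E τ) - K * (m * τ ^ (m - 1))) τ := fun τ hτ =>
        ((Real.hasDerivAt_rpow_const (Or.inl hτ.ne')).mul (hder τ hτ)).sub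
          ((Real.hasDerivAt_rpow_const (Or.inl hτ.ne')).const_mul K)
      refine antitoneOn_of_deriv_nonpos (convex_Icc _ _) ?_ ?_ ?_
      · intro τ hτ
        exact (hdv τ (hτ₀0.trans_le hτ.1)).continuousAt.continuousWithinAt
      · intro τ hτ
        rw [interior_Icc] at hτ
        exact (hdv τ (hτ₀0.trans hτ.1)).differentiableAt.differentiableWithinAt
      · intro τ hτ
        rw [interior_Icc] at hτ
        have hτ0 : 0 < τ := hτ₀0.trans hτ.1
        rw [(hdv τ hτ0).deriv]
        -- The radius `(τ / (k A)) ^ (1 / α)` makes `A r ^ α E = τ E / k`, so the energy cancels in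
        -- the derivative of `τ ^ k u`, and the remainder is exactly the derivative of `K τ ^ m`.
        have hq : 0 < τ / (k * A) := by positivity
        have hrα : ((τ / (k * A)) ^ (1 / α)) ^ α = τ / (k * A) := by
          rw [← Real.rpow_mul hq.le]; simp [hα.ne']
        have hrd : ((τ / (k * A)) ^ (1 / α)) ^ (-d) = (k * A) ^ β * τ ^ (-β) := by
          rw [← Real.rpow_mul hq.le, show 1 / α * -d = -β by rw [hβd]; ring,
            Real.div_rpow hτ0.le hkA0.le, Real.rpow_neg hkA0.le, div_inv_eq_mul, mul_comm]
        have hlow : R ^ θ ≤ (τ / (k * A)) ^ (1 / α) := by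
          have h1 : R ^ θ = (R ^ (θ * α)) ^ (1 / α) := by
            rw [← Real.rpow_mul hR0.le]; congr 1; field_simp
          rw [h1]
          refine Real.rpow_le_rpow (by positivity) ?_ (by positivity)
          rw [le_div_iff₀ hkA0]
          have := hτ.1.le
          rw [hτ₀] at this; linarith
        have hupp : (τ / (k * A)) ^ (1 / α) ≤ R := by
          have h1 : R = (R ^ α) ^ (1 / α) := by
            rw [← Real.rpow_mul hR0.le]; simp [hα.ne']
          conv_rhs => rw [h1]
          refine Real.rpow_le_rpow hq.le ?_ (by positivity)
          exact (div_le_self hτ0.le hkA).trans ((hτ.2.le.trans hst).trans htR)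
        have hn := hnash τ hτ0 _ hlow hupp
        rw [hrα, hrd] at hn
        have e1 : τ ^ k = τ ^ (k - 1) * τ := by
          rw [← Real.rpow_add_one hτ0.ne']; simp
        have e2 : τ ^ (m - 1) = τ ^ (k - 1) * τ ^ (-β) := by
          rw [← Real.rpow_add hτ0]; congr 1; rw [hk]; ring
        have e3 : K * m = k * A * (k * A) ^ β := by rw [hK]; field_simp
        have hp : 0 < τ ^ (k - 1) := by positivity
        have e4 : k * τ ^ (k - 1) * u τ + τ ^ k * -E τ - K * (m * τ ^ (m - 1)) =
            τ ^ (k - 1) * k * (u τ - (A * (τ / (k * A)) * E τ +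
              A * ((k * A) ^ β * τ ^ (-β)))) := by
          rw [e1, e2, ← mul_assoc, e3]
          field_simp
          ring
        rw [e4]
        exact mul_nonpos_of_nonneg_of_nonpos (by positivity) (by linarith)
    have h1 := hanti ⟨le_rfl, hsτ.le⟩ ⟨hsτ.le, le_rfl⟩ hsτ.le
    dsimp only at h1
    have h2 : τ₀ ^ k * u τ₀ ≤ (k * A) ^ k * t ^ m * c :=
      (mul_le_mul_of_nonneg_left (huc _ hτ₀0.le) (by positivity)).trans
        (mul_le_mul_of_nonneg_right hτk hc.le)
    have h3 : 0 ≤ K * τ₀ ^ m := by positivity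
    have h4 : K * s ^ m ≤ K * t ^ m := mul_le_mul_of_nonneg_left hstm hK0.le
    linarith
-- Elementary inequalities for the regularised entropy.
/-- Minus the regularised entropy density `a log a`. -/
noncomputable def entropyDensity (ε a : ℝ) : ℝ :=
  ε * Real.log ε - (a + ε) * Real.log (a + ε)

lemma entropyDensity_zero (ε : ℝ) : entropyDensity ε 0 = 0 := by simp [entropyDensity]

lemma hasDerivAt_entropyDensity {ε a : ℝ} (hε : 0 < ε) (ha : 0 ≤ a) :
    HasDerivAt (entropyDensity ε) (-(Real.log (a + ε) + 1)) a := by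
  have h : a + ε ≠ 0 := by positivity
  have h1 := (Real.hasDerivAt_mul_log h).comp_add_const a ε
  exact h1.const_sub (ε * Real.log ε)

lemma abs_log_add_one_le {ε a c : ℝ} (hε : 0 < ε) (ha : 0 ≤ a) (hac : a ≤ c) :
    |-(Real.log (a + ε) + 1)| ≤ |Real.log ε| + |Real.log (c + ε)| + 1 := by
  have h1 : Real.log ε ≤ Real.log (a + ε) := Real.log_le_log hε (by linarith)
  have h2 : Real.log (a + ε) ≤ Real.log (c + ε) := Real.log_le_log (by linarith) (by linarith)
  rw [abs_neg, abs_le]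
  have h3 := neg_abs_le (Real.log ε)
  have h4 := le_abs_self (Real.log (c + ε))
  have h5 := abs_nonneg (Real.log ε)
  have h6 := abs_nonneg (Real.log (c + ε))
  constructor <;> linarith

/-- The logarithm lies below its tangent at `v`. The `-a` this produces compensates the loss `ε (log
(a + ε) - log ε) ≤ a` caused by the regularisation. -/
lemma entropyDensity_lower {ε a v : ℝ} (hε : 0 < ε) (ha : 0 ≤ a) (hv : 0 < v) :
    -Real.log v * a - v⁻¹ * (a * a) - v⁻¹ * ε * a ≤ entropyDensity ε a := by
  have hA : 0 < a + ε := by linarith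
  have h1 : Real.log (a + ε) ≤ Real.log v + ((a + ε) / v - 1) := by
    have := Real.log_le_sub_one_of_pos (div_pos hA hv)
    rw [Real.log_div hA.ne' hv.ne'] at this; linarith
  have h2 : ε * (Real.log (a + ε) - Real.log ε) ≤ a := by
    have := Real.log_le_sub_one_of_pos (div_pos hA hε)
    rw [Real.log_div hA.ne' hε.ne'] at this
    have h3 := mul_le_mul_of_nonneg_left this hε.le
    have h4 : ε * ((a + ε) / ε - 1) = a := by field_simp; ring
    linarith
  have h3 := mul_le_mul_of_nonneg_left h1 ha
  have h4 : (a + ε) / v = v⁻¹ * a + v⁻¹ * ε := by field_simp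
  rw [h4] at h3
  unfold entropyDensity
  linarith

/-- Young duality between `a log a` and the exponential; here the regularisation has a favourable
sign. -/
lemma entropyDensity_upper {ε a : ℝ} (hε : 0 < ε) (ha : 0 ≤ a) (l : ℝ) :
    entropyDensity ε a ≤ a * l + Real.exp (-l) := by
  have hA : 0 < a + ε := by linarith
  have h1 : Real.log ε ≤ Real.log (a + ε) := Real.log_le_log hε (by linarith)
  have h2 : entropyDensity ε a ≤ -(a * Real.log (a + ε)) := by
    unfold entropyDensity
    nlinarith
  refine h2.trans ?_
  rcases ha.eq_or_lt with rfl | ha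
  · simp [(Real.exp_pos (-l)).le]
  have h3 : Real.log a ≤ Real.log (a + ε) := Real.log_le_log ha (by linarith)
  have h4 := Real.log_le_sub_one_of_pos (div_pos (Real.exp_pos (-l)) ha)
  rw [Real.log_div (Real.exp_pos _).ne' ha.ne', Real.log_exp] at h4
  have h5 := mul_le_mul_of_nonneg_left h4 ha.le
  have h6 : a * (Real.exp (-l) / a - 1) = Real.exp (-l) - a := by field_simp
  have h7 := mul_le_mul_of_nonneg_left h3 ha.le
  linarith

lemma sq_sub_div_add_le {A B : ℝ} (hA : 0 < A) (hB : 0 < B) :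
    (A - B) ^ 2 / (A + B) ≤ (A - B) * (Real.log A - Real.log B) := by
  wlog hAB : B ≤ A generalizing A B
  · have := this hB hA (le_of_not_ge hAB)
    rw [add_comm] at this
    linarith [show (A - B) ^ 2 / (A + B) = (B - A) ^ 2 / (A + B) by congr 1; ring]
  have h1 := Real.log_le_sub_one_of_pos (div_pos hB hA)
  rw [Real.log_div hB.ne' hA.ne'] at h1
  have h2 : (A - B) / (A + B) ≤ Real.log A - Real.log B := by
    have h3 : (A - B) / (A + B) ≤ (A - B) / A :=
      div_le_div_of_nonneg_left (by linarith) hA (by linarith)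
    have h4 : (A - B) / A = 1 - B / A := by field_simp
    linarith
  have := mul_le_mul_of_nonneg_left h2 (sub_nonneg.2 hAB)
  refine le_trans (le_of_eq ?_) this
  ring

/-- Complete the square, then replace `(A - B) ^ 2 / (A + B)` by the entropy production. The weight
`c` is free and later depends on time. -/
lemma mul_sub_le_entropy {A B c e : ℝ} (hA : 0 < A) (hB : 0 < B) (hc : 0 < c) :
    -(e * (A - B)) ≤ c / 2 * (e ^ 2 * (A + B)) +
      1 / (2 * c) * ((Real.log A - Real.log B) * (A - B)) := by
  have h1 := sq_sub_div_add_le hA hB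
  have h2 : -(e * (A - B)) ≤ c / 2 * (e ^ 2 * (A + B)) +
      1 / (2 * c) * ((A - B) ^ 2 / (A + B)) := by
    have hS : 0 < A + B := by linarith
    have : c / 2 * (e ^ 2 * (A + B)) + 1 / (2 * c) * ((A - B) ^ 2 / (A + B)) + e * (A - B) =
        (c * e * (A + B) + (A - B)) ^ 2 / (2 * c * (A + B)) := by field_simp; ring
    have h3 : 0 ≤ (c * e * (A + B) + (A - B)) ^ 2 / (2 * c * (A + B)) := by positivity
    linarith
  have h3 := mul_le_mul_of_nonneg_left h1 (show 0 ≤ 1 / (2 * c) by positivity)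
  linarith

/-! ### The entropy method for the first moment. -/

namespace HeatFlow

variable {V : Type*} {μ : V → ℝ} {k : V → V → ℝ} {c lam : ℝ} {x : V} {p : ℝ → V → ℝ}

/-- The regularised entropy at time `t`. -/
noncomputable def entropy (μ : V → ℝ) (p : ℝ → V → ℝ) (ε t : ℝ) : ℝ :=
  ∑' y, μ y * entropyDensity ε (p t y)

/-- The mean of `g` at time `t`. -/
noncomputable def mean (μ : V → ℝ) (p : ℝ → V → ℝ) (g : V → ℝ) (t : ℝ) : ℝ :=
  ∑' y, μ y * (g y * p t y)

lemma summable_entropy (h : HeatFlow μ k c lam x p) {ε t : ℝ} (hε : 0 < ε) (ht : 0 ≤ t) :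
    Summable fun y => μ y * entropyDensity ε (p t y) :=
  h.summable_functional (Φ := fun _ => entropyDensity ε) (fun _ => entropyDensity_zero ε)
    (fun _ _ ha => hasDerivAt_entropyDensity hε ha)
    (fun _ _ ha hac => abs_log_add_one_le hε ha hac) ht

lemma continuousOn_entropy (h : HeatFlow μ k c lam x p) {ε : ℝ} (hε : 0 < ε) :
    ContinuousOn (entropy μ p ε) (Ici 0) :=
  h.continuousOn_functional (Φ := fun _ => entropyDensity ε) (fun _ => entropyDensity_zero ε)
    (fun _ _ ha => hasDerivAt_entropyDensity hε ha)
    (fun _ _ ha hac => abs_log_add_one_le hε ha hac)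

lemma hasDerivAt_entropy (h : HeatFlow μ k c lam x p) {ε t : ℝ} (hε : 0 < ε) (ht : 0 < t) :
    HasDerivAt (entropy μ p ε) (1 / 2 * ∑' q : V × V, k q.1 q.2 *
      ((Real.log (p t q.1 + ε) - Real.log (p t q.2 + ε)) * (p t q.1 - p t q.2))) t := by
  refine (h.hasDerivAt_functional (Φ := fun _ => entropyDensity ε)
    (fun _ => entropyDensity_zero ε) (fun _ _ ha => hasDerivAt_entropyDensity hε ha)
    (fun _ _ ha hac => abs_log_add_one_le hε ha hac) ht).congr_deriv ?_
  rw [neg_mul, ← mul_neg, ← tsum_neg]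
  congr 1
  exact tsum_congr fun q => by ring

lemma summable_entropy_production (h : HeatFlow μ k c lam x p) {ε t : ℝ} (hε : 0 < ε)
    (ht : 0 ≤ t) : Summable fun q : V × V => k q.1 q.2 *
      ((Real.log (p t q.1 + ε) - Real.log (p t q.2 + ε)) * (p t q.1 - p t q.2)) := by
  refine h.summable_bdd_mul ht (B := 2 * (|Real.log ε| + |Real.log (c + ε)| + 1)) fun q => ?_
  rw [abs_mul]
  refine mul_le_mul ?_ (h.abs_sub_le ht _ _) (abs_nonneg _) (by positivity)
  have h1 := abs_log_add_one_le hε (h.nonneg t ht q.1) (h.le_c ht q.1)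
  have h2 := abs_log_add_one_le hε (h.nonneg t ht q.2) (h.le_c ht q.2)
  rw [abs_le] at *
  constructor <;> linarith [h1.1, h1.2, h2.1, h2.2]

lemma summable_mean (h : HeatFlow μ k c lam x p) {g : V → ℝ} {N : ℝ} (hg : ∀ y, |g y| ≤ N)
    {t : ℝ} (ht : 0 ≤ t) : Summable fun y => μ y * (g y * p t y) :=
  h.summable_functional (Φ := fun y a => g y * a) (φ := fun y _ => g y) (fun y => mul_zero _)
    (fun y a _ => by simpa using (hasDerivAt_id a).const_mul (g y)) (fun y _ _ _ => hg y) ht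

lemma continuousOn_mean (h : HeatFlow μ k c lam x p) {g : V → ℝ} {N : ℝ}
    (hg : ∀ y, |g y| ≤ N) : ContinuousOn (mean μ p g) (Ici 0) :=
  h.continuousOn_functional (Φ := fun y a => g y * a) (φ := fun y _ => g y)
    (fun y => mul_zero _)
    (fun y a _ => by simpa using (hasDerivAt_id a).const_mul (g y)) (fun y _ _ _ => hg y)

lemma hasDerivAt_mean (h : HeatFlow μ k c lam x p) {g : V → ℝ} {N : ℝ}
    (hg : ∀ y, |g y| ≤ N) {t : ℝ} (ht : 0 < t) :
    HasDerivAt (mean μ p g) (-(1 / 2) * ∑' q : V × V, k q.1 q.2 *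
      ((g q.1 - g q.2) * (p t q.1 - p t q.2))) t :=
  h.hasDerivAt_functional (Φ := fun y a => g y * a) (φ := fun y _ => g y)
    (fun y => mul_zero _)
    (fun y a _ => by simpa using (hasDerivAt_id a).const_mul (g y)) (fun y _ _ _ => hg y) ht

lemma mean_zero (h : HeatFlow μ k c lam x p) {g : V → ℝ} (hg : g x = 0) : mean μ p g 0 = 0 := by
  unfold mean
  rw [← tsum_zero (α := ℝ) (β := V)]
  refine tsum_congr fun y => ?_
  by_cases hy : y = x
  · simp [hy, hg]
  · simp [h.initial y hy]

/-- A small `L²` norm forces spreading, as in Jensen's inequality. The `2` collects one unit from `∑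
μ p² / v ≤ 1` and one from `ε / v ≤ 1`. -/
lemma entropy_lower (h : HeatFlow μ k c lam x p) {ε t v : ℝ} (hε : 0 < ε) (ht : 0 ≤ t)
    (hεv : ε ≤ v) (hv : ∑' y, μ y * (p t y * p t y) ≤ v) :
    -Real.log v - 2 ≤ entropy μ p ε t := by
  have hv0 : 0 < v := hε.trans_le hεv
  have s1 := (h.hasSum t ht).summable
  have s2 : Summable fun y => μ y * (p t y * p t y) :=
    h.summable_mean (g := p t) (N := c)
      (fun y => by rw [abs_of_nonneg (h.nonneg t ht y)]; exact h.le_c ht y) ht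
  have key : ∑' y, (-Real.log v * (μ y * p t y) - v⁻¹ * (μ y * (p t y * p t y)) -
      v⁻¹ * ε * (μ y * p t y)) ≤ entropy μ p ε t := by
    refine Summable.tsum_le_tsum (fun y => ?_)
      (((s1.mul_left _).sub (s2.mul_left _)).sub (s1.mul_left _)) (h.summable_entropy hε ht)
    have := mul_le_mul_of_nonneg_left (entropyDensity_lower hε (h.nonneg t ht y) hv0)
      (h.mass_pos y).le
    linarith
  rw [((s1.mul_left _).sub (s2.mul_left _)).tsum_sub (s1.mul_left _),
    (s1.mul_left _).tsum_sub (s2.mul_left _), tsum_mul_left, tsum_mul_left, tsum_mul_left,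
    (h.hasSum t ht).tsum_eq] at key
  have h1 : v⁻¹ * ε ≤ 1 := by rw [inv_mul_le_iff₀ hv0]; linarith
  have h2 : v⁻¹ * ∑' y, μ y * (p t y * p t y) ≤ 1 := by rw [inv_mul_le_iff₀ hv0]; linarith
  linarith

/-- The Gibbs variational bound: `l` is arbitrary, and will be an affine function of the distance to
`x`. -/
lemma entropy_upper (h : HeatFlow μ k c lam x p) {ε t : ℝ} (hε : 0 < ε) (ht : 0 ≤ t)
    {l : V → ℝ} (hl : Summable fun y => μ y * (l y * p t y))
    (he : Summable fun y => μ y * Real.exp (-l y)) :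
    entropy μ p ε t ≤ mean μ p l t + ∑' y, μ y * Real.exp (-l y) := by
  unfold mean
  rw [← hl.tsum_add he]
  refine (h.summable_entropy hε ht).tsum_le_tsum (fun y => ?_) (hl.add he)
  have := mul_le_mul_of_nonneg_left (entropyDensity_upper hε (h.nonneg t ht y) (l y))
    (h.mass_pos y).le
  linarith

lemma summable_energy (h : HeatFlow μ k c lam x p) {g : V → ℝ} {N : ℝ} (hg : ∀ y, |g y| ≤ N)
    (hs : Summable fun q : V × V => k q.1 q.2 * (g q.1 - g q.2) ^ 2) {ε t : ℝ} (ht : 0 ≤ t) :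
    Summable fun q : V × V => k q.1 q.2 *
      ((g q.1 - g q.2) ^ 2 * ((p t q.1 + ε) + (p t q.2 + ε))) := by
  have h1 : Summable fun q : V × V => k q.1 q.2 *
      ((g q.1 - g q.2) ^ 2 * (p t q.1 + p t q.2)) := by
    refine h.summable_bdd_mul ht (B := (2 * N) ^ 2) fun q => ?_
    have h0 : 0 ≤ p t q.1 + p t q.2 := add_nonneg (h.nonneg t ht _) (h.nonneg t ht _)
    rw [abs_mul, abs_of_nonneg h0, abs_of_nonneg (sq_nonneg _)]
    refine mul_le_mul_of_nonneg_right ?_ h0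
    have h2 := abs_le.1 (hg q.1)
    have h3 := abs_le.1 (hg q.2)
    refine sq_le_sq' ?_ ?_ <;> linarith
  refine (h1.add (hs.mul_left (2 * ε))).congr fun q => ?_
  ring

lemma summable_mean_flow (h : HeatFlow μ k c lam x p) {g : V → ℝ} {N : ℝ}
    (hg : ∀ y, |g y| ≤ N) {t : ℝ} (ht : 0 ≤ t) :
    Summable fun q : V × V => k q.1 q.2 * ((g q.1 - g q.2) * (p t q.1 - p t q.2)) := by
  refine h.summable_bdd_mul ht (B := 2 * N) fun q => ?_
  have h2 := abs_le.1 (hg q.1)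
  have h3 := abs_le.1 (hg q.2)
  rw [abs_mul]
  refine mul_le_mul ?_ (h.abs_sub_le ht _ _) (abs_nonneg _) (by linarith)
  rw [abs_le]; constructor <;> linarith

/-- Differential form of the comparison of the mean displacement with the entropy. -/
lemma mean_flow_le (h : HeatFlow μ k c lam x p) {g : V → ℝ} {N : ℝ} (hg : ∀ y, |g y| ≤ N)
    (hs : Summable fun q : V × V => k q.1 q.2 * (g q.1 - g q.2) ^ 2) {ε t D e : ℝ} (hε : 0 < ε)
    (ht : 0 ≤ t) (he : 0 < e)
    (hD : 1 / 2 * ∑' q : V × V, k q.1 q.2 *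
      ((g q.1 - g q.2) ^ 2 * ((p t q.1 + ε) + (p t q.2 + ε))) ≤ D) :
    -(1 / 2) * ∑' q : V × V, k q.1 q.2 * ((g q.1 - g q.2) * (p t q.1 - p t q.2)) ≤
      e / 2 * D + 1 / (2 * e) * (1 / 2 * ∑' q : V × V, k q.1 q.2 *
        ((Real.log (p t q.1 + ε) - Real.log (p t q.2 + ε)) * (p t q.1 - p t q.2))) := by
  have s1 := h.summable_energy hg hs (ε := ε) ht
  have s2 := h.summable_entropy_production hε ht
  have s3 := h.summable_mean_flow hg ht
  have key := s3.neg.tsum_le_tsum (fun q => ?_)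
    ((s1.mul_left (e / 2)).add (s2.mul_left (1 / (2 * e))))
  · rw [tsum_neg, (s1.mul_left (e / 2)).tsum_add (s2.mul_left (1 / (2 * e))), tsum_mul_left,
      tsum_mul_left] at key
    have := mul_le_mul_of_nonneg_left hD (show 0 ≤ e / 2 by positivity)
    linarith
  · have h1 := mul_le_mul_of_nonneg_left (mul_sub_le_entropy
      (A := p t q.1 + ε) (B := p t q.2 + ε) (e := g q.1 - g q.2)
      (by linarith [h.nonneg t ht q.1]) (by linarith [h.nonneg t ht q.2]) he)
      (h.k_nonneg q.1 q.2)
    rw [show p t q.1 + ε - (p t q.2 + ε) = p t q.1 - p t q.2 by ring] at h1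
    linarith

/-- Integrated form of the comparison of the mean displacement with the entropy. -/
lemma mean_le_entropy (h : HeatFlow μ k c lam x p) {g : V → ℝ} {N : ℝ} (hg : ∀ y, |g y| ≤ N)
    (hgx : g x = 0) (hs : Summable fun q : V × V => k q.1 q.2 * (g q.1 - g q.2) ^ 2)
    {ε t D κ n C : ℝ} (hε : 0 < ε) (ht : 0 < t) (hκ : 0 < κ)
    (hD : ∀ s, 0 ≤ s → 1 / 2 * ∑' q : V × V, k q.1 q.2 *
      ((g q.1 - g q.2) ^ 2 * ((p s q.1 + ε) + (p s q.2 + ε))) ≤ D)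
    (hQ : ∀ s, 0 < s → s ≤ t → n * Real.log s - C ≤ entropy μ p ε s) :
    mean μ p g t ≤ κ * D * √t +
      √t / (2 * κ) * (entropy μ p ε t - n * Real.log t + 2 * n + C) := by
  -- `G` is the claimed inequality in integrated form. Its last term is an antiderivative of `(n log
  -- s - C) / (4 κ √s)`, the lower bound for what integrating `√s Q'` by parts leaves. Writing it
  -- with `√s log √s` makes `G` continuous at `0`, so no integrability of `Q'` near `0` is needed.
  set G : ℝ → ℝ := fun s => mean μ p g s - κ * D * √s - 1 / (2 * κ) * (√s * entropy μ p ε s) +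
    1 / (4 * κ) * (4 * n * (√s * Real.log √s) - (4 * n + 2 * C) * √s) with hG
  have hder : ∀ s, 0 < s → HasDerivAt G (
      -(1 / 2) * ∑' q : V × V, k q.1 q.2 * ((g q.1 - g q.2) * (p s q.1 - p s q.2)) -
      κ * D * (1 / (2 * √s)) - 1 / (2 * κ) * (1 / (2 * √s) * entropy μ p ε s +
        √s * (1 / 2 * ∑' q : V × V, k q.1 q.2 *
        ((Real.log (p s q.1 + ε) - Real.log (p s q.2 + ε)) * (p s q.1 - p s q.2)))) +
      1 / (4 * κ) * (4 * n * ((Real.log √s + 1) * (1 / (2 * √s))) -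
        (4 * n + 2 * C) * (1 / (2 * √s)))) s := by
    intro s hs0
    have hr := Real.hasDerivAt_sqrt hs0.ne'
    have hr0 : √s ≠ 0 := (Real.sqrt_pos.2 hs0).ne'
    have hl := (Real.hasDerivAt_mul_log hr0).comp s hr
    exact (((h.hasDerivAt_mean hg hs0).sub (hr.const_mul (κ * D))).sub
      ((hr.mul (h.hasDerivAt_entropy hε hs0)).const_mul _)).add
      (((hl.const_mul (4 * n)).sub (hr.const_mul (4 * n + 2 * C))).const_mul _)
  have hcont : ContinuousOn G (Icc 0 t) := by
    have c1 := (h.continuousOn_mean hg).mono (Icc_subset_Ici_self : Icc 0 t ⊆ Ici 0)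
    have c2 := (h.continuousOn_entropy hε).mono (Icc_subset_Ici_self : Icc 0 t ⊆ Ici 0)
    have c3 : Continuous fun s : ℝ => √s * Real.log √s :=
      Real.continuous_mul_log.comp Real.continuous_sqrt
    have c4 : Continuous fun s : ℝ => √s := Real.continuous_sqrt
    exact ((c1.sub (c4.continuousOn.const_mul _)).sub
      ((c4.continuousOn.mul c2).const_mul _)).add
      ((((c3.const_mul _).sub (c4.const_mul _)).const_mul _).continuousOn)
  have hanti : AntitoneOn G (Icc 0 t) := by
    refine antitoneOn_of_deriv_nonpos (convex_Icc _ _) hcont ?_ ?_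
    · intro s hs'
      rw [interior_Icc] at hs'
      exact (hder s hs'.1).differentiableAt.differentiableWithinAt
    · intro s hs'
      rw [interior_Icc] at hs'
      have hs0 := hs'.1
      rw [(hder s hs0).deriv]
      have hσ : 0 < √s := Real.sqrt_pos.2 hs0
      -- The weight `κ / √s` balances the two terms when the entropy production decays like `1 / s`.
      have h1 := h.mean_flow_le hg hs (e := κ / √s) hε hs0.le (by positivity) (hD s hs0.le)
      have h2 := hQ s hs0 hs'.2.le
      rw [show Real.log s = 2 * Real.log √s by rw [Real.log_sqrt hs0.le]; ring] at h2
      set X := ∑' q : V × V, k q.1 q.2 *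
        ((Real.log (p s q.1 + ε) - Real.log (p s q.2 + ε)) * (p s q.1 - p s q.2))
      set Y := -(1 / 2) * ∑' q : V × V, k q.1 q.2 * ((g q.1 - g q.2) * (p s q.1 - p s q.2))
      have h3 : κ / √s / 2 * D + 1 / (2 * (κ / √s)) * (1 / 2 * X) =
        κ * D * (1 / (2 * √s)) + 1 / (2 * κ) * (√s * (1 / 2 * X)) := by field_simp
      have h4 : 1 / (4 * κ) * (4 * n * ((Real.log √s + 1) * (1 / (2 * √s))) -
        (4 * n + 2 * C) * (1 / (2 * √s))) - 1 / (2 * κ) * (1 / (2 * √s) * entropy μ p ε s) =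
        1 / (4 * κ * √s) * (n * (2 * Real.log √s) - C - entropy μ p ε s) := by
        field_simp; ring
      have h5 : 1 / (4 * κ * √s) * (n * (2 * Real.log √s) - C - entropy μ p ε s) ≤ 0 :=
        mul_nonpos_of_nonneg_of_nonpos (by positivity) (by linarith)
      linarith
  have h0 : G 0 = 0 := by simp [hG, h.mean_zero hgx]
  have h1 := hanti ⟨le_rfl, ht.le⟩ ⟨ht.le, le_rfl⟩ ht.le
  rw [h0] at h1
  have h2 : Real.log t = 2 * Real.log √t := by rw [Real.log_sqrt ht.le]; ring
  have h3 : G t = mean μ p g t - (κ * D * √t +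
      √t / (2 * κ) * (entropy μ p ε t - n * Real.log t + 2 * n + C)) := by
    rw [hG, h2]; field_simp; ring
  linarith

/-- By symmetry both endpoints contribute equally, and the total mass is one; this gives one `D`.
The regularisation costs at most another. -/
lemma energy_le (h : HeatFlow μ k c lam x p) {g : V → ℝ} {N D ε t : ℝ} (hg : ∀ y, |g y| ≤ N)
    (hs : Summable fun q : V × V => k q.1 q.2 * (g q.1 - g q.2) ^ 2)
    (hΓ : ∀ y, ∑' z, k y z * (g y - g z) ^ 2 ≤ D * μ y)
    (hε : ε * ∑' q : V × V, k q.1 q.2 * (g q.1 - g q.2) ^ 2 ≤ D) (ht : 0 ≤ t) :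
    1 / 2 * ∑' q : V × V, k q.1 q.2 *
      ((g q.1 - g q.2) ^ 2 * ((p t q.1 + ε) + (p t q.2 + ε))) ≤ 2 * D := by
  have hb : ∀ q : V × V, (g q.1 - g q.2) ^ 2 ≤ (2 * N) ^ 2 := fun q => by
    have h2 := abs_le.1 (hg q.1)
    have h3 := abs_le.1 (hg q.2)
    refine sq_le_sq' ?_ ?_ <;> linarith
  have s1 : Summable fun q : V × V => k q.1 q.2 * ((g q.1 - g q.2) ^ 2 * p t q.1) := by
    refine h.summable_bdd_mul ht (B := (2 * N) ^ 2) fun q => ?_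
    have h0 := h.nonneg t ht q.1
    have h0' := h.nonneg t ht q.2
    rw [abs_mul, abs_of_nonneg h0, abs_of_nonneg (sq_nonneg _)]
    exact mul_le_mul (hb q) (by linarith) h0 (sq_nonneg _)
  have s2 : Summable fun q : V × V => k q.1 q.2 * ((g q.1 - g q.2) ^ 2 * p t q.2) := by
    refine h.summable_bdd_mul ht (B := (2 * N) ^ 2) fun q => ?_
    have h0 := h.nonneg t ht q.1
    have h0' := h.nonneg t ht q.2
    rw [abs_mul, abs_of_nonneg h0', abs_of_nonneg (sq_nonneg _)]
    exact mul_le_mul (hb q) (by linarith) h0' (sq_nonneg _)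
  have e1 : ∑' q : V × V, k q.1 q.2 * ((g q.1 - g q.2) ^ 2 * p t q.2) =
      ∑' q : V × V, k q.1 q.2 * ((g q.1 - g q.2) ^ 2 * p t q.1) := by
    rw [← (Equiv.prodComm V V).tsum_eq]
    refine tsum_congr fun q => ?_
    simp only [Equiv.prodComm_apply, Prod.fst_swap, Prod.snd_swap, h.k_symm q.2 q.1]
    ring
  have e2 : ∑' q : V × V, k q.1 q.2 * ((g q.1 - g q.2) ^ 2 * p t q.1) ≤ D := by
    have h1 : D = ∑' y, D * (μ y * p t y) := by
      rw [tsum_mul_left, (h.hasSum t ht).tsum_eq, mul_one]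
    rw [s1.tsum_prod, h1]
    refine s1.prod.tsum_le_tsum (fun y => ?_) ((h.hasSum t ht).summable.mul_left D)
    have h2 : ∑' z, k y z * ((g y - g z) ^ 2 * p t y) =
        (∑' z, k y z * (g y - g z) ^ 2) * p t y := by
      rw [← tsum_mul_right]
      exact tsum_congr fun z => by ring
    rw [h2, ← mul_assoc]
    exact mul_le_mul_of_nonneg_right (hΓ y) (h.nonneg t ht y)
  have e3 : ∑' q : V × V, k q.1 q.2 *
      ((g q.1 - g q.2) ^ 2 * ((p t q.1 + ε) + (p t q.2 + ε))) =
      ∑' q : V × V, k q.1 q.2 * ((g q.1 - g q.2) ^ 2 * p t q.1) +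
      ∑' q : V × V, k q.1 q.2 * ((g q.1 - g q.2) ^ 2 * p t q.2) +
      2 * ε * ∑' q : V × V, k q.1 q.2 * (g q.1 - g q.2) ^ 2 := by
    rw [← tsum_mul_left, ← s1.tsum_add s2, ← (s1.add s2).tsum_add (hs.mul_left _)]
    exact tsum_congr fun q => by ring
  rw [e3, e1]
  linarith

/-- A crude linear bound, independent of the truncation of `g`, which shows that the first moment is
finite. This has to be known beforehand, since the main estimate has the moment on both sides. -/
lemma mean_le_mul (h : HeatFlow μ k c lam x p) {g : V → ℝ} {N D ε t : ℝ} (hε : 0 < ε)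
    (hg : ∀ y, |g y| ≤ N) (hgx : g x = 0)
    (hint : ∀ y z, |g y - g z| ≤ (g y - g z) ^ 2)
    (hs : Summable fun q : V × V => k q.1 q.2 * (g q.1 - g q.2) ^ 2) (ht : 0 ≤ t)
    (hD : ∀ s, 0 ≤ s → 1 / 2 * ∑' q : V × V, k q.1 q.2 *
      ((g q.1 - g q.2) ^ 2 * ((p s q.1 + ε) + (p s q.2 + ε))) ≤ D) :
    mean μ p g t ≤ D * t := by
  have hder : ∀ s, 0 < s → -(1 / 2) * ∑' q : V × V, k q.1 q.2 *
      ((g q.1 - g q.2) * (p s q.1 - p s q.2)) ≤ D := by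
    intro s hs0
    have key := (h.summable_mean_flow hg hs0.le).neg.tsum_le_tsum (fun q => ?_)
      (h.summable_energy hg hs (ε := ε) hs0.le)
    · rw [tsum_neg] at key
      linarith [hD s hs0.le]
    · rw [← mul_neg]
      refine mul_le_mul_of_nonneg_left ?_ (h.k_nonneg _ _)
      refine (neg_le_abs _).trans ?_
      rw [abs_mul]
      refine mul_le_mul (hint _ _) ((h.abs_sub_le hs0.le _ _).trans ?_) (abs_nonneg _)
        (sq_nonneg _)
      linarith
  have hanti : AntitoneOn (fun s => mean μ p g s - D * s) (Ici 0) := by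
    have hd : ∀ s, 0 < s → HasDerivAt (fun s => mean μ p g s - D * s) _ s := fun s hs0 =>
      (h.hasDerivAt_mean hg hs0).sub ((hasDerivAt_id s).const_mul D)
    refine antitoneOn_of_deriv_nonpos (convex_Ici _) ?_ ?_ ?_
    · exact (h.continuousOn_mean hg).sub (Continuous.continuousOn (by fun_prop))
    · intro s hs0
      rw [interior_Ici] at hs0
      exact (hd s hs0).differentiableAt.differentiableWithinAt
    · intro s hs0
      rw [interior_Ici] at hs0
      rw [(hd s hs0).deriv]
      linarith [hder s hs0]
  have := hanti (mem_Ici.2 le_rfl) (mem_Ici.2 ht) ht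
  simp only [h.mean_zero hgx, mul_zero, sub_zero] at this
  linarith

lemma abs_min_sub_min_le (a b N : ℕ) :
    |((min a N : ℕ) : ℝ) - ((min b N : ℕ) : ℝ)| ≤ |(a : ℝ) - b| := by
  have := abs_min_sub_min_le_max (a : ℝ) N b N
  push_cast
  simpa using this

lemma abs_natCast_sub_le_sq (a b : ℕ) : |(a : ℝ) - b| ≤ ((a : ℝ) - b) ^ 2 := by
  have h : |(a : ℤ) - b| ≤ ((a : ℤ) - b) ^ 2 := by
    rw [← sq_abs]
    exact Int.le_self_sq _
  exact_mod_cast h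

/-- The entropy method: a bound for the first moment in terms of itself, the growth of `μ` and
the decay of the `L²` norm of the density. -/
lemma moment_le (h : HeatFlow μ k c lam x p) {ρ : V → ℕ} (hρx : ρ x = 0) {D : ℝ} (hD : 0 < D)
    (hfin : ∀ N : ℕ, Summable fun q : V × V =>
      k q.1 q.2 * (((min (ρ q.1) N : ℕ) : ℝ) - ((min (ρ q.2) N : ℕ) : ℝ)) ^ 2)
    (hΓs : ∀ y, Summable fun z => k y z * ((ρ y : ℝ) - ρ z) ^ 2)
    (hΓ : ∀ y, ∑' z, k y z * ((ρ y : ℝ) - ρ z) ^ 2 ≤ D * μ y)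
    {n b Cv d : ℝ} (hn : 0 < n) (hvs : Summable fun y => μ y * Real.exp (-(b * ρ y / n)))
    (hv : ∑' y, μ y * Real.exp (-(b * ρ y / n)) ≤ Cv * n ^ d)
    {β m C t κ : ℝ} (hC : 0 < C) (ht : 0 < t) (hκ : 0 < κ) (hβm : 0 ≤ β + m)
    (hdec : ∀ s, 0 < s → s ≤ t → s ^ (β + m) * ∑' y, μ y * (p s y * p s y) ≤ C * t ^ m) :
    (Summable fun y => μ y * ((ρ y : ℝ) * p t y)) ∧
      mean μ p (fun y => ρ y) t ≤ κ * (2 * D) * √t + √t / (2 * κ) *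
        (b / n * mean μ p (fun y => ρ y) t + d * Real.log n + Cv - β * Real.log t +
          2 * (β + m) + Real.log C + 2) := by
  set g : ℕ → V → ℝ := fun N y => ((min (ρ y) N : ℕ) : ℝ) with hgdef
  set W : ℕ → ℝ := fun N => ∑' q : V × V, k q.1 q.2 * (g N q.1 - g N q.2) ^ 2 with hW
  -- The first bound keeps `ε` below the `L²` bound at every time up to `t`; the second makes the
  -- regularised energy at most `2 * D`.
  set ε : ℕ → ℝ := fun N => min (C * t ^ (-β)) (D / (W N + 1)) with hεdef
  have hW0 : ∀ N, 0 ≤ W N := fun N =>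
    tsum_nonneg fun q => mul_nonneg (h.k_nonneg _ _) (sq_nonneg _)
  have hε : ∀ N, 0 < ε N := fun N =>
    lt_min (by positivity) (div_pos hD (by linarith [hW0 N]))
  have hεW : ∀ N, ε N * W N ≤ D := fun N => by
    have h1 : ε N ≤ D / (W N + 1) := min_le_right _ _
    have h2 := hW0 N
    rw [le_div_iff₀ (by linarith)] at h1
    nlinarith [hε N]
  have hg : ∀ N y, |g N y| ≤ N := fun N y => by
    rw [abs_of_nonneg (Nat.cast_nonneg _)]
    exact Nat.cast_le.2 (min_le_right _ _)
  have hgx : ∀ N, g N x = 0 := fun N => by simp [hgdef, hρx]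
  have hΓg : ∀ N y, ∑' z, k y z * (g N y - g N z) ^ 2 ≤ D * μ y := fun N y => by
    have hle : ∀ z, k y z * (g N y - g N z) ^ 2 ≤ k y z * ((ρ y : ℝ) - ρ z) ^ 2 := fun z =>
      mul_le_mul_of_nonneg_left (sq_le_sq.2 (abs_min_sub_min_le _ _ _)) (h.k_nonneg _ _)
    refine le_trans (Summable.tsum_le_tsum hle ?_ (hΓs y)) (hΓ y)
    exact (hΓs y).of_nonneg_of_le (fun z => mul_nonneg (h.k_nonneg _ _) (sq_nonneg _)) hle
  have hen : ∀ N s, 0 ≤ s → 1 / 2 * ∑' q : V × V, k q.1 q.2 *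
      ((g N q.1 - g N q.2) ^ 2 * ((p s q.1 + ε N) + (p s q.2 + ε N))) ≤ 2 * D :=
    fun N s hs0 => h.energy_le (hg N) (hfin N) (hΓg N) (hεW N) hs0
  -- Finite partial sums of the full mean are dominated by truncated means, so bounds uniform in `N`
  -- pass to the full mean.
  have hsum_le : ∀ (F : Finset V), ∃ N,
      ∑ y ∈ F, μ y * ((ρ y : ℝ) * p t y) ≤ mean μ p (g N) t := fun F => by
    refine ⟨F.sup ρ, ?_⟩
    have h1 : ∑ y ∈ F, μ y * ((ρ y : ℝ) * p t y) = ∑ y ∈ F, μ y * (g (F.sup ρ) y * p t y) :=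
      Finset.sum_congr rfl fun y hy => by
        rw [hgdef]
        dsimp only
        rw [min_eq_left (Finset.le_sup hy)]
    rw [h1]
    exact (h.summable_mean (hg _) ht.le).sum_le_tsum F fun y _ =>
      mul_nonneg (h.mass_pos y).le (mul_nonneg (Nat.cast_nonneg _) (h.nonneg t ht.le y))
  have hρ0 : ∀ y, 0 ≤ μ y * ((ρ y : ℝ) * p t y) := fun y =>
    mul_nonneg (h.mass_pos y).le (mul_nonneg (Nat.cast_nonneg _) (h.nonneg t ht.le y))
  have hsm : Summable fun y => μ y * ((ρ y : ℝ) * p t y) := by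
    refine summable_of_sum_le hρ0 (c := 2 * D * t) fun F => ?_
    obtain ⟨N, hN⟩ := hsum_le F
    exact hN.trans (h.mean_le_mul (hε N) (hg N) (hgx N)
      (fun y z => abs_natCast_sub_le_sq _ _) (hfin N) ht.le (hen N))
  refine ⟨hsm, hsm.tsum_le_of_sum_le fun F => ?_⟩
  obtain ⟨N, hN⟩ := hsum_le F
  refine hN.trans ?_
  -- Once this is integrated, `m log t` cancels against part of `(β + m) log t`: the weaker decay at
  -- small times costs only a constant.
  have hQ : ∀ s, 0 < s → s ≤ t →
      (β + m) * Real.log s - (Real.log C + m * Real.log t + 2) ≤ entropy μ p (ε N) s := by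
    intro s hs0 hst
    have hv0 : 0 < C * t ^ m / s ^ (β + m) := by positivity
    have h1 : ε N ≤ C * t ^ m / s ^ (β + m) := by
      refine (min_le_left _ _).trans ?_
      rw [le_div_iff₀ (by positivity)]
      have h2 : s ^ (β + m) ≤ t ^ (β + m) := Real.rpow_le_rpow hs0.le hst hβm
      have h3 : t ^ (-β) * t ^ (β + m) = t ^ m := by
        rw [← Real.rpow_add ht]; congr 1; ring
      rw [← h3, mul_assoc]
      refine mul_le_mul_of_nonneg_left ?_ hC.le
      exact mul_le_mul_of_nonneg_left h2 (by positivity)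
    have h2 : ∑' y, μ y * (p s y * p s y) ≤ C * t ^ m / s ^ (β + m) := by
      rw [le_div_iff₀ (by positivity), mul_comm]
      exact hdec s hs0 hst
    have h3 := h.entropy_lower (hε N) hs0.le h1 h2
    rw [Real.log_div (by positivity) (by positivity), Real.log_mul hC.ne' (by positivity),
      Real.log_rpow ht, Real.log_rpow hs0] at h3
    linarith
  have hmain := h.mean_le_entropy (hg N) (hgx N) (hfin N) (hε N) ht hκ (hen N) hQ
  refine hmain.trans ?_
  have hexp : ∀ y, μ y * Real.exp (-(b * ρ y / n + d * Real.log n)) =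
      μ y * Real.exp (-(b * ρ y / n)) * n ^ (-d) := fun y => by
    rw [neg_add, Real.exp_add, Real.rpow_def_of_pos hn, mul_assoc]
    congr 3; ring
  have hls : ∀ y, μ y * ((b * ρ y / n + d * Real.log n) * p t y) =
      b / n * (μ y * ((ρ y : ℝ) * p t y)) + d * Real.log n * (μ y * p t y) := fun y => by ring
  have s1 := (h.hasSum t ht.le).summable
  -- The additive `d log n` normalises the exponential volume `Cv n ^ d` to `Cv`.
  have hup := h.entropy_upper (hε N) ht.le (l := fun y => b * ρ y / n + d * Real.log n)
    (((hsm.mul_left _).add (s1.mul_left _)).congr fun y => (hls y).symm)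
    ((hvs.mul_right _).congr fun y => (hexp y).symm)
  have e1 : mean μ p (fun y => b * ρ y / n + d * Real.log n) t =
      b / n * mean μ p (fun y => ρ y) t + d * Real.log n := by
    unfold mean
    rw [tsum_congr hls, (hsm.mul_left _).tsum_add (s1.mul_left _), tsum_mul_left, tsum_mul_left,
      (h.hasSum t ht.le).tsum_eq, mul_one]
  have e2 : ∑' y, μ y * Real.exp (-(b * ρ y / n + d * Real.log n)) ≤ Cv := by
    rw [tsum_congr hexp, tsum_mul_right]
    refine (mul_le_mul_of_nonneg_right hv (by positivity)).trans (le_of_eq ?_)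
    rw [mul_assoc, ← Real.rpow_add hn, add_neg_cancel, Real.rpow_zero, mul_one]
  rw [e1] at hup
  have hpos : 0 ≤ √t / (2 * κ) := by positivity
  have := mul_le_mul_of_nonneg_left (hup.trans (add_le_add_right e2 _)) hpos
  nlinarith

end HeatFlow

/-! ### Balls, kernel moments and volume growth. -/

section Geometry

variable {V : Type*} {G : SimpleGraph V} {μ : V → ℝ} {d cM cG : ℝ} {rG : EReal}

lemma exists_dist_eq (hG : G.Connected) (x y : V) {i : ℕ} (hi : i ≤ G.dist x y) :
    ∃ z, G.dist x z = i ∧ G.dist z y = G.dist x y - i := by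
  obtain ⟨w, hw⟩ := hG.exists_walk_length_eq_dist x y
  refine ⟨w.getVert i, ?_⟩
  have h1 : G.dist x (w.getVert i) ≤ i := by
    refine (SimpleGraph.dist_le (w.take i)).trans ?_
    rw [SimpleGraph.Walk.take_length]; exact min_le_left _ _
  have h2 : G.dist (w.getVert i) y ≤ G.dist x y - i := by
    refine (SimpleGraph.dist_le (w.drop i)).trans ?_
    rw [SimpleGraph.Walk.drop_length, hw]
  have h3 := hG.dist_triangle (u := x) (v := w.getVert i) (w := y)
  omega

lemma finite_ball (h : IsDSetGraph G μ d cM cG rG) (x : V) (r : ℝ) : (ball G x r).Finite := by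
  have key : ∀ n : ℕ, {y | G.dist x y ≤ n}.Finite := by
    intro n
    induction n with
    | zero =>
      refine (Set.finite_singleton x).subset fun y hy => ?_
      have : G.dist x y = 0 := Nat.le_zero.1 hy
      exact ((h.connected.dist_eq_zero_iff).1 this).symm
    | succ n ih =>
      refine (ih.union (ih.biUnion fun z _ => h.locallyFinite z)).subset fun y hy => ?_
      have hy' : G.dist x y ≤ n + 1 := hy
      rcases Nat.lt_or_ge n (G.dist x y) with h1 | h1
      · obtain ⟨z, hz1, hz2⟩ := exists_dist_eq h.connected x y h1.le
        refine Or.inr (Set.mem_biUnion (x := z) (show G.dist x z ≤ n from hz1.le) ?_)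
        exact SimpleGraph.dist_eq_one_iff_adj.1 (by omega)
      · exact Or.inl h1
  refine (key ⌈r⌉₊).subset fun y hy => ?_
  have h1 : (G.dist x y : ℝ) ≤ ⌈r⌉₊ := (show (G.dist x y : ℝ) ≤ r from hy).trans (Nat.le_ceil r)
  exact_mod_cast h1

/-- The ball as a finite set. -/
noncomputable def ballFinset (h : IsDSetGraph G μ d cM cG rG) (x : V) (r : ℝ) : Finset V :=
  (finite_ball h x r).toFinset

lemma mem_ballFinset (h : IsDSetGraph G μ d cM cG rG) {x y : V} {r : ℝ} :
    y ∈ ballFinset h x r ↔ (G.dist x y : ℝ) ≤ r := by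
  simp [ballFinset, ball]

lemma tsum_subtype_eq_sum {A : Set V} (hA : A.Finite) (f : V → ℝ) :
    ∑' y : A, f y = ∑ y ∈ hA.toFinset, f y := by
  rw [tsum_subtype, tsum_eq_sum (s := hA.toFinset)]
  · exact Finset.sum_congr rfl fun y hy => Set.indicator_of_mem (hA.mem_toFinset.1 hy) _
  · intro y hy
    exact Set.indicator_of_notMem (fun hy' => hy (hA.mem_toFinset.2 hy')) _

lemma mass_ball_eq (h : IsDSetGraph G μ d cM cG rG) (x : V) (r : ℝ) :
    mass μ (ball G x r) = ∑ y ∈ ballFinset h x r, μ y :=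
  tsum_subtype_eq_sum (finite_ball h x r) μ

lemma sum_ball_le (h : IsDSetGraph G μ d cM cG rG) (x : V) {r : ℝ} (hr : 1 ≤ r)
    (hrG : (r : EReal) < rG) : ∑ y ∈ ballFinset h x r, μ y ≤ cG * r ^ d :=
  (mass_ball_eq h x r).symm.le.trans (h.mass_ball_le x r hr hrG)

lemma le_sum_ball (h : IsDSetGraph G μ d cM cG rG) (x : V) {r : ℝ} (hr : 1 ≤ r)
    (hrG : (r : EReal) < rG) : cG⁻¹ * r ^ d ≤ ∑ y ∈ ballFinset h x r, μ y :=
  (h.le_mass_ball x r hr hrG).trans (mass_ball_eq h x r).le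

lemma IsDSetGraph.mass_pos (h : IsDSetGraph G μ d cM cG rG) (hcM : 1 ≤ cM) (y : V) : 0 < μ y :=
  (inv_pos.2 (by linarith)).trans_le (h.le_mass_point y)

lemma EReal_lt_of_le {r R : ℝ} (h : r ≤ R) (hR : (R : EReal) < rG) : (r : EReal) < rG :=
  lt_of_le_of_lt (EReal.coe_le_coe_iff.2 h) hR

/-- Second moment of the stable-like kernel truncated at `r`. -/
lemma sum_ball_rpow_le {α : ℝ} (h : IsDSetGraph G μ d cM cG rG) (hd : 0 < d) (hα : 0 < α)
    (hα2 : α < 2) (hcM : 1 ≤ cM) (hcG : 1 ≤ cG) (y : V) {r : ℝ} (hr : 0 < r)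
    (hrG : (r : EReal) < rG) :
    ∑ z ∈ ballFinset h y r, 1 / (G.dist y z : ℝ) ^ (d + α) * (G.dist y z : ℝ) ^ 2 * μ z ≤
      2 ^ (d + α) * cG / (1 - 2 ^ (-(2 - α))) * r ^ (2 - α) := by
  set C := (2 : ℝ) ^ (d + α) * cG with hC
  have hC0 : 0 < C := by positivity
  set q := (2 : ℝ) ^ (-(2 - α)) with hq
  have hq1 : q < 1 := Real.rpow_lt_one_of_one_lt_of_neg (by norm_num) (by linarith)
  have hq1' : 0 < 1 - q := by linarith
  set f : V → ℝ := fun z => 1 / (G.dist y z : ℝ) ^ (d + α) * (G.dist y z : ℝ) ^ 2 * μ z with hf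
  have hf0 : ∀ z, 0 ≤ f z := fun z =>
    mul_nonneg (by positivity) (h.mass_pos hcM z).le
  -- Dyadic induction on the scale. Below radius one the ball is its centre, which contributes zero.
  have key : ∀ n : ℕ, ∀ r : ℝ, 0 < r → r < 2 ^ n → (r : EReal) < rG →
      ∑ z ∈ ballFinset h y r, f z ≤ C / (1 - q) * r ^ (2 - α) := by
    have hsmall : ∀ r : ℝ, 0 < r → r < 1 →
        ∑ z ∈ ballFinset h y r, f z ≤ C / (1 - q) * r ^ (2 - α) := by
      intro r hr hr1
      have : ∑ z ∈ ballFinset h y r, f z = 0 := Finset.sum_eq_zero fun z hz => by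
        rw [mem_ballFinset] at hz
        have h1 : (G.dist y z : ℝ) < 1 := hz.trans_lt hr1
        have h2 : G.dist y z = 0 := by
          have : G.dist y z < 1 := by exact_mod_cast h1
          omega
        simp [hf, h2]
      rw [this]; positivity
    intro n
    induction n with
    | zero => intro r hr hr1 _; exact hsmall r hr (by simpa using hr1)
    | succ n ih =>
      intro r hr hrn hrG
      rcases lt_or_ge r 1 with hr1 | hr1
      · exact hsmall r hr hr1
      have ih' := ih (r / 2) (by positivity) (by rw [pow_succ] at hrn; linarith)
        (EReal_lt_of_le (by linarith) hrG)
      have hsplit : ∑ z ∈ ballFinset h y r, f z ≤ ∑ z ∈ ballFinset h y (r / 2), f z +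
          ∑ z ∈ ballFinset h y r, 2 ^ (d + α) * r ^ (2 - (d + α)) * μ z := by
        classical
        rw [← Finset.sum_filter_add_sum_filter_not (ballFinset h y r)
          (fun z => (G.dist y z : ℝ) ≤ r / 2)]
        refine add_le_add ?_ ?_
        · refine Finset.sum_le_sum_of_subset_of_nonneg (fun z hz => ?_) fun z _ _ => hf0 z
          exact (mem_ballFinset h).2 (Finset.mem_filter.1 hz).2
        · refine (Finset.sum_le_sum fun z hz => ?_).trans
            (Finset.sum_le_sum_of_subset_of_nonneg (Finset.filter_subset _ _) fun z _ _ => ?_)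
          · obtain ⟨hz1, hz2⟩ := Finset.mem_filter.1 hz
            rw [mem_ballFinset] at hz1
            push Not at hz2
            refine mul_le_mul_of_nonneg_right ?_ (h.mass_pos hcM z).le
            have hr2 : (0 : ℝ) < r / 2 := by positivity
            have h1 : (r / 2) ^ (d + α) ≤ (G.dist y z : ℝ) ^ (d + α) :=
              Real.rpow_le_rpow hr2.le hz2.le (by positivity)
            have h2 : 1 / (G.dist y z : ℝ) ^ (d + α) ≤ 1 / (r / 2) ^ (d + α) :=
              one_div_le_one_div_of_le (by positivity) h1
            have h3 : (G.dist y z : ℝ) ^ 2 ≤ r ^ 2 := by gcongr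
            refine (mul_le_mul h2 h3 (by positivity) (by positivity)).trans (le_of_eq ?_)
            rw [Real.div_rpow hr.le (by norm_num), Real.rpow_sub hr]
            norm_num
            field_simp
          · exact mul_nonneg (by positivity) (h.mass_pos hcM z).le
      have h2 : ∑ z ∈ ballFinset h y r, 2 ^ (d + α) * r ^ (2 - (d + α)) * μ z ≤
          C * r ^ (2 - α) := by
        rw [← Finset.mul_sum]
        refine (mul_le_mul_of_nonneg_left (sum_ball_le h y hr1 hrG) (by positivity)).trans
          (le_of_eq ?_)
        rw [show 2 - α = (2 - (d + α)) + d by ring, Real.rpow_add hr, hC]; ring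
      have h3 : (r / 2) ^ (2 - α) = q * r ^ (2 - α) := by
        rw [Real.div_rpow hr.le (by norm_num), hq, Real.rpow_neg (by norm_num)]; field_simp
      rw [h3] at ih'
      -- The constant `C / (1 - q)` is the fixed point of halving: `q` times it for the inner ball,
      -- plus `C` for the annulus.
      have h4 : C / (1 - q) * r ^ (2 - α) =
          C / (1 - q) * (q * r ^ (2 - α)) + C * r ^ (2 - α) := by
        field_simp; ring
      linarith
  obtain ⟨n, hn⟩ := pow_unbounded_of_one_lt r (by norm_num : (1 : ℝ) < 2)
  exact key n r hr hn hrG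

/-- Volume bounds at radii `n` and `3n` alone control all larger balls, even beyond `rG`. Each `y`
in the larger ball has within `3n` a ball of radius `n` inside the smaller one; double counting the
pairs `(u, y)` with `ρ(u, y) ≤ 3n` gives the factor. -/
lemma sum_ball_succ_le (h : IsDSetGraph G μ d cM cG rG) (hcM : 1 ≤ cM) (hcG : 1 ≤ cG)
    (x : V) {n : ℕ} (hn : 1 ≤ n) (hnG : ((3 * n : ℝ) : EReal) < rG) (j : ℕ) :
    ∑ y ∈ ballFinset h x ((j + 2 : ℕ) * n : ℝ), μ y ≤
      cG ^ 2 * 3 ^ d * ∑ y ∈ ballFinset h x ((j + 1 : ℕ) * n : ℝ), μ y := by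
  classical
  have hn1 : (1 : ℝ) ≤ n := by exact_mod_cast hn
  have hnd : (0 : ℝ) < (n : ℝ) ^ d := by positivity
  have hμ := h.mass_pos hcM
  set A := ballFinset h x ((j + 2 : ℕ) * n : ℝ)
  set B := ballFinset h x ((j + 1 : ℕ) * n : ℝ)
  have h1 : ∀ y ∈ A, (1 : ℝ) ≤ cG * ((n : ℝ) ^ d)⁻¹ *
      ∑ u ∈ B, if (G.dist u y : ℝ) ≤ 3 * n then μ u else 0 := by
    intro y hy
    have hy' : G.dist x y ≤ (j + 2) * n := by
      have := (mem_ballFinset h).1 hy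
      exact_mod_cast this
    -- A point on a geodesic from `x` to `y`, at distance `min (j n) ρ(x, y)` from `x`.
    obtain ⟨z, hz1, hz2⟩ : ∃ z, G.dist x z ≤ j * n ∧ G.dist z y ≤ 2 * n := by
      obtain ⟨z, hz1, hz2⟩ := exists_dist_eq h.connected x y (min_le_right (j * n) _)
      refine ⟨z, hz1.le.trans (min_le_left _ _), ?_⟩
      rw [hz2]
      have : (j + 2) * n = j * n + 2 * n := by ring
      omega
    have h2 := le_sum_ball h z hn1 (EReal_lt_of_le (by linarith) hnG)
    have h3 : ∑ u ∈ ballFinset h z (n : ℝ), μ u ≤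
        ∑ u ∈ B, if (G.dist u y : ℝ) ≤ 3 * n then μ u else 0 := by
      rw [← Finset.sum_filter]
      refine Finset.sum_le_sum_of_subset_of_nonneg (fun u hu => ?_) fun u _ _ => (hμ u).le
      have hu' : G.dist z u ≤ n := by
        have := (mem_ballFinset h).1 hu
        exact_mod_cast this
      have t1 := h.connected.dist_triangle (u := x) (v := z) (w := u)
      have t2 := h.connected.dist_triangle (u := u) (v := z) (w := y)
      rw [SimpleGraph.dist_comm (u := u) (v := z)] at t2
      rw [Finset.mem_filter, mem_ballFinset]
      constructor
      · have : G.dist x u ≤ (j + 1) * n := by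
          have : (j + 1) * n = j * n + n := by ring
          omega
        exact_mod_cast this
      · have : G.dist u y ≤ 3 * n := by omega
        exact_mod_cast this
    have hcG0 : 0 < cG := by linarith
    have h4 := mul_le_mul_of_nonneg_left (h2.trans h3)
      (show 0 ≤ cG * ((n : ℝ) ^ d)⁻¹ by positivity)
    refine le_trans (le_of_eq ?_) h4
    field_simp
  calc ∑ y ∈ A, μ y
      ≤ ∑ y ∈ A, μ y * (cG * ((n : ℝ) ^ d)⁻¹ *
          ∑ u ∈ B, if (G.dist u y : ℝ) ≤ 3 * n then μ u else 0) :=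
        Finset.sum_le_sum fun y hy => le_mul_of_one_le_right (hμ y).le (h1 y hy)
    _ = cG * ((n : ℝ) ^ d)⁻¹ * ∑ u ∈ B, μ u *
          ∑ y ∈ A, if (G.dist u y : ℝ) ≤ 3 * n then μ y else 0 := by
        simp_rw [Finset.mul_sum]
        rw [Finset.sum_comm]
        refine Finset.sum_congr rfl fun u _ => Finset.sum_congr rfl fun y _ => ?_
        split_ifs <;> ring
    _ ≤ cG * ((n : ℝ) ^ d)⁻¹ * ∑ u ∈ B, μ u * (cG * (3 * n : ℝ) ^ d) := by
        refine mul_le_mul_of_nonneg_left (Finset.sum_le_sum fun u _ => ?_) (by positivity)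
        refine mul_le_mul_of_nonneg_left ?_ (hμ u).le
        refine le_trans ?_ (sum_ball_le h u (by linarith) hnG)
        rw [← Finset.sum_filter]
        refine Finset.sum_le_sum_of_subset_of_nonneg (fun y hy => ?_) fun u _ _ => (hμ u).le
        exact (mem_ballFinset h).2 (Finset.mem_filter.1 hy).2
    _ = cG ^ 2 * 3 ^ d * ∑ y ∈ B, μ y := by
        rw [← Finset.sum_mul, Real.mul_rpow (by norm_num) (by linarith)]
        field_simp

lemma sum_ball_mul_le (h : IsDSetGraph G μ d cM cG rG) (hcM : 1 ≤ cM) (hcG : 1 ≤ cG)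
    (x : V) {n : ℕ} (hn : 1 ≤ n) (hnG : ((3 * n : ℝ) : EReal) < rG) (j : ℕ) :
    ∑ y ∈ ballFinset h x ((j + 1 : ℕ) * n : ℝ), μ y ≤
      cG * (n : ℝ) ^ d * (cG ^ 2 * 3 ^ d) ^ j := by
  have hn1 : (1 : ℝ) ≤ n := by exact_mod_cast hn
  induction j with
  | zero => simpa using sum_ball_le h x hn1 (EReal_lt_of_le (by linarith) hnG)
  | succ j ih =>
    refine (sum_ball_succ_le h hcM hcG x hn hnG j).trans ?_
    rw [pow_succ (cG ^ 2 * 3 ^ d) j]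
    have := mul_le_mul_of_nonneg_left ih (show 0 ≤ cG ^ 2 * (3 : ℝ) ^ d by positivity)
    linarith

/-- Exponential volume growth at the scale `n`. -/
lemma exp_growth (h : IsDSetGraph G μ d cM cG rG) (hd : 0 < d) (hcM : 1 ≤ cM) (hcG : 1 ≤ cG)
    (x : V) {n : ℕ} (hn : 1 ≤ n) (hnG : ((3 * n : ℝ) : EReal) < rG) :
    (Summable fun y => μ y *
        Real.exp (-(Real.log (2 * (cG ^ 2 * 3 ^ d)) * (G.dist x y : ℝ) / n))) ∧
      ∑' y, μ y * Real.exp (-(Real.log (2 * (cG ^ 2 * 3 ^ d)) * (G.dist x y : ℝ) / n)) ≤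
        2 * cG * (n : ℝ) ^ d := by
  classical
  have hcG0 : 0 < cG := by linarith
  have hn1 : (1 : ℝ) ≤ n := by exact_mod_cast hn
  have h3d : (1 : ℝ) ≤ 3 ^ d := Real.one_le_rpow (by norm_num) hd.le
  set Λ := cG ^ 2 * (3 : ℝ) ^ d with hΛ
  have hΛ1 : 1 ≤ Λ := by nlinarith [one_le_pow₀ hcG (n := 2)]
  have hμ := h.mass_pos hcM
  set b := Real.log (2 * Λ) with hb
  have hb0 : 0 ≤ b := Real.log_nonneg (by linarith)
  -- Rounding the distance down to a multiple of `n` makes the weight constant on annuli. The base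
  -- `2 Λ` beats the growth rate `Λ` by a factor `2`, leaving a geometric series of sum at most `2`.
  have hexp : ∀ y, Real.exp (-(b * (G.dist x y : ℝ) / n)) ≤ ((2 * Λ)⁻¹) ^ (G.dist x y / n) := by
    intro y
    have h1 : ((2 * Λ)⁻¹) ^ (G.dist x y / n) =
        Real.exp (-(b * ((G.dist x y / n : ℕ) : ℝ))) := by
      rw [inv_pow, Real.exp_neg, mul_comm b, Real.exp_nat_mul, hb, Real.exp_log (by linarith)]
    rw [h1]
    refine Real.exp_le_exp.2 (neg_le_neg ?_)
    rw [mul_div_assoc]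
    exact mul_le_mul_of_nonneg_left Nat.cast_div_le hb0
  have hbound : ∀ F : Finset V,
      ∑ y ∈ F, μ y * Real.exp (-(b * (G.dist x y : ℝ) / n)) ≤ 2 * cG * (n : ℝ) ^ d := by
    intro F
    set J := F.sup (fun y => G.dist x y / n) + 1
    calc ∑ y ∈ F, μ y * Real.exp (-(b * (G.dist x y : ℝ) / n))
        ≤ ∑ y ∈ F, μ y * ((2 * Λ)⁻¹) ^ (G.dist x y / n) :=
          Finset.sum_le_sum fun y _ => mul_le_mul_of_nonneg_left (hexp y) (hμ y).le
      _ = ∑ j ∈ Finset.range J, ∑ y ∈ F with G.dist x y / n = j,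
            μ y * ((2 * Λ)⁻¹) ^ (G.dist x y / n) := by
          refine (Finset.sum_fiberwise_of_maps_to (fun y hy => ?_) _).symm
          rw [Finset.mem_range]
          exact Nat.lt_succ_of_le (Finset.le_sup (f := fun y => G.dist x y / n) hy)
      _ ≤ ∑ j ∈ Finset.range J, cG * (n : ℝ) ^ d * (1 / 2) ^ j := by
          refine Finset.sum_le_sum fun j _ => ?_
          have e1 : ∑ y ∈ F with G.dist x y / n = j, μ y * ((2 * Λ)⁻¹) ^ (G.dist x y / n) =
              ((2 * Λ)⁻¹) ^ j * ∑ y ∈ F with G.dist x y / n = j, μ y := by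
            rw [Finset.mul_sum]
            refine Finset.sum_congr rfl fun y hy => ?_
            rw [(Finset.mem_filter.1 hy).2, mul_comm]
          have e2 : ∑ y ∈ F with G.dist x y / n = j, μ y ≤ cG * (n : ℝ) ^ d * Λ ^ j := by
            refine le_trans ?_ (sum_ball_mul_le h hcM hcG x hn hnG j)
            refine Finset.sum_le_sum_of_subset_of_nonneg (fun y hy => ?_) fun u _ _ => (hμ u).le
            rw [mem_ballFinset]
            have h1 := (Finset.mem_filter.1 hy).2
            have h2 : G.dist x y < (j + 1) * n := by
              rw [← Nat.div_lt_iff_lt_mul (by omega)]; omega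
            exact_mod_cast h2.le
          rw [e1]
          refine (mul_le_mul_of_nonneg_left e2 (by positivity)).trans (le_of_eq ?_)
          rw [mul_left_comm, ← mul_pow]
          congr 2
          field_simp
      _ ≤ 2 * cG * (n : ℝ) ^ d := by
          rw [← Finset.mul_sum]
          have h1 : ∑ j ∈ Finset.range J, ((1 : ℝ) / 2) ^ j ≤ 2 := by
            have := Summable.sum_le_tsum (Finset.range J)
              (fun j _ => by positivity) summable_geometric_two
            rwa [tsum_geometric_two] at this
          have := mul_le_mul_of_nonneg_left h1 (show 0 ≤ cG * (n : ℝ) ^ d by positivity)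
          linarith
  have h0 : ∀ y, 0 ≤ μ y * Real.exp (-(b * (G.dist x y : ℝ) / n)) := fun y =>
    mul_nonneg (hμ y).le (Real.exp_pos _).le
  have hs := summable_of_sum_le h0 hbound
  exact ⟨hs, hs.tsum_le_of_sum_le hbound⟩

end Geometry

/-! ### Localized conductances and the pointwise Nash estimate. -/

section Conductance

variable {V : Type*} {G : SimpleGraph V} {μ : V → ℝ} {d α cM cG : ℝ} {rG : EReal}
  {w : V → V → ℝ} {x₀ : V} {R r C₁ C₂ : ℝ}

lemma localized_symm (hw : IsConductance G μ d α w) (y z : V) :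
    localized G w x₀ R y z = localized G w x₀ R z y := by
  unfold localized
  rw [hw.symm y z]
  by_cases h : y ∈ ball G x₀ R ∨ z ∈ ball G x₀ R
  · rw [if_pos h, if_pos h.symm]
  · rw [if_neg h, if_neg fun h' => h h'.symm]

lemma localized_nonneg (hw : IsConductance G μ d α w) (y z : V) :
    0 ≤ localized G w x₀ R y z := by
  unfold localized
  split_ifs
  · exact hw.nonneg y z
  · exact zero_le_one

lemma localized_eq_or (y z : V) :
    localized G w x₀ R y z = w y z ∨ localized G w x₀ R y z = 1 := by
  unfold localized
  split_ifs
  · exact Or.inl rfl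
  · exact Or.inr rfl

/-- An edge of length at most `R` starting outside `B(x₀, 3R)` cannot reach `B(x₀, R)`. This extends
the scale bounds from `B(x₀, 3R)` to all centres. -/
lemma localized_eq_one (h : IsDSetGraph G μ d cM cG rG) {y z : V} (hR : 0 ≤ R)
    (hy : y ∉ ball G x₀ (3 * R)) (hz : (G.dist y z : ℝ) ≤ R) : localized G w x₀ R y z = 1 := by
  unfold localized
  rw [if_neg]
  have hy' : 3 * R < G.dist x₀ y := not_le.1 hy
  rintro (h1 | h1)
  · have h1' : (G.dist x₀ y : ℝ) ≤ R := h1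
    linarith
  · have h1' : (G.dist x₀ z : ℝ) ≤ R := h1
    have h2 : (G.dist x₀ y : ℝ) ≤ G.dist x₀ z + G.dist z y := by
      exact_mod_cast h.connected.dist_triangle
    rw [SimpleGraph.dist_comm (u := z)] at h2
    linarith

lemma finite_posBall (h : IsDSetGraph G μ d cM cG rG) (v : V → V → ℝ) (y : V) (r : ℝ) :
    (posBall G v y r).Finite := (finite_ball h y r).subset fun _ hz => hz.1

lemma card_ball_le (h : IsDSetGraph G μ d cM cG rG) (hcM : 1 ≤ cM) (y : V) (hr : 1 ≤ r)
    (hrG : (r : EReal) < rG) :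
    ((ballFinset h y r).card : ℝ) ≤ cM * cG * r ^ d := by
  have hcM0 : 0 < cM := by linarith
  have h1 : ((ballFinset h y r).card : ℝ) ≤ ∑ z ∈ ballFinset h y r, cM * μ z := by
    rw [Finset.card_eq_sum_ones, Nat.cast_sum]
    refine Finset.sum_le_sum fun z _ => ?_
    have := mul_le_mul_of_nonneg_left (h.le_mass_point z) hcM0.le
    rw [mul_inv_cancel₀ hcM0.ne'] at this
    simpa using this
  rw [← Finset.mul_sum] at h1
  have := mul_le_mul_of_nonneg_left (sum_ball_le h y hr hrG) hcM0.le
  linarith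

lemma mass_posBall_localized (h : IsDSetGraph G μ d cM cG rG) (hcM : 1 ≤ cM) (hr : 1 ≤ r)
    (hrR : r ≤ R) (hRG : (R : EReal) < rG)
    (hS : ScaleBounds G μ d α w x₀ C₁ C₂ R r) (y : V) :
    min C₂ cG⁻¹ * r ^ d ≤
      ∑ z ∈ (finite_posBall h (localized G w x₀ R) y r).toFinset, μ z := by
  have hrd : 0 ≤ r ^ d := by positivity
  by_cases hy : y ∈ ball G x₀ (3 * R)
  · have h1 := hS.mass_posBall y hy
    unfold mass at h1
    rw [tsum_subtype_eq_sum (finite_posBall h w y r)] at h1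
    refine (mul_le_mul_of_nonneg_right (min_le_left _ _) hrd).trans (h1.trans ?_)
    refine Finset.sum_le_sum_of_subset_of_nonneg (fun z hz => ?_)
      fun z _ _ => (h.mass_pos hcM z).le
    rw [Set.Finite.mem_toFinset] at hz ⊢
    refine ⟨hz.1, ?_⟩
    rcases localized_eq_or (G := G) (w := w) (x₀ := x₀) (R := R) y z with e | e
    · rw [e]; exact hz.2
    · rw [e]; exact zero_lt_one
  · have h1 := le_sum_ball h y hr (EReal_lt_of_le hrR hRG)
    refine (mul_le_mul_of_nonneg_right (min_le_right _ _) hrd).trans (h1.trans ?_)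
    refine Finset.sum_le_sum_of_subset_of_nonneg (fun z hz => ?_)
      fun z _ _ => (h.mass_pos hcM z).le
    rw [Set.Finite.mem_toFinset]
    have hz' := (mem_ballFinset h).1 hz
    refine ⟨hz', ?_⟩
    rw [localized_eq_one h (by linarith) hy (hz'.trans hrR)]
    exact zero_lt_one

/-- Inside `B(x₀, 3R)` each localized conductance is the original one or `1`, so the inverse sum
grows by at most the cardinality of the ball. -/
lemma inverse_sum_localized (h : IsDSetGraph G μ d cM cG rG) (hw : IsConductance G μ d α w)
    (hcM : 1 ≤ cM) (hC₁ : 0 < C₁) (hr : 1 ≤ r)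
    (hrR : r ≤ R) (hRG : (R : EReal) < rG)
    (hS : ScaleBounds G μ d α w x₀ C₁ C₂ R r) (y : V) :
    ∑ z ∈ (finite_posBall h (localized G w x₀ R) y r).toFinset, (localized G w x₀ R y z)⁻¹ ≤
      (C₁ + cM * cG) * r ^ d := by
  classical
  set P := (finite_posBall h (localized G w x₀ R) y r).toFinset
  have hP : ∀ z ∈ P, z ∈ ballFinset h y r := fun z hz =>
    (mem_ballFinset h).2 ((Set.Finite.mem_toFinset _).1 hz).1
  have hrd : 0 ≤ r ^ d := by positivity
  have hcard := card_ball_le h hcM y hr (EReal_lt_of_le hrR hRG)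
  have hcardP : (P.card : ℝ) ≤ (ballFinset h y r).card :=
    Nat.cast_le.2 (Finset.card_le_card hP)
  by_cases hy : y ∈ ball G x₀ (3 * R)
  · have h1 := hS.inverse_sum y hy
    rw [tsum_subtype_eq_sum (finite_posBall h w y r) fun z => (w y z)⁻¹] at h1
    have h2 : ∀ z ∈ P, (localized G w x₀ R y z)⁻¹ ≤
        (if z ∈ posBall G w y r then (w y z)⁻¹ else 0) + 1 := by
      intro z hz
      have hz' := (Set.Finite.mem_toFinset _).1 hz
      rcases localized_eq_or (G := G) (w := w) (x₀ := x₀) (R := R) y z with e | e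
      · have : z ∈ posBall G w y r := ⟨hz'.1, e ▸ hz'.2⟩
        rw [e, if_pos this]; linarith
      · rw [e, inv_one]
        have : 0 ≤ if z ∈ posBall G w y r then (w y z)⁻¹ else 0 := by
          split_ifs
          · exact inv_nonneg.2 (hw.nonneg y z)
          · exact le_rfl
        linarith
    refine (Finset.sum_le_sum h2).trans ?_
    rw [Finset.sum_add_distrib, ← Finset.sum_filter]
    have h3 : ∑ z ∈ P with z ∈ posBall G w y r, (w y z)⁻¹ ≤
        ∑ z ∈ (finite_posBall h w y r).toFinset, (w y z)⁻¹ :=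
      Finset.sum_le_sum_of_subset_of_nonneg
        (fun z hz => (Set.Finite.mem_toFinset _).2 (Finset.mem_filter.1 hz).2)
        fun z _ _ => inv_nonneg.2 (hw.nonneg y z)
    have h4 : ∑ z ∈ P, (1 : ℝ) = P.card := by simp
    linarith
  · have h2 : ∀ z ∈ P, (localized G w x₀ R y z)⁻¹ ≤ 1 := by
      intro z hz
      rw [localized_eq_one h (by linarith) hy (((mem_ballFinset h).1 (hP z hz)).trans hrR),
        inv_one]
    have h4 : ∑ z ∈ P, (1 : ℝ) = P.card := by simp
    have h5 := Finset.sum_le_sum h2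
    have h6 : 0 ≤ C₁ * r ^ d := by positivity
    linarith

lemma second_moment_localized (h : IsDSetGraph G μ d cM cG rG) (hw : IsConductance G μ d α w)
    (hd : 0 < d) (hα : 0 < α) (hα2 : α < 2) (hcM : 1 ≤ cM) (hcG : 1 ≤ cG) (hC₁ : 0 < C₁)
    (hR : 1 ≤ R) (hRG : (R : EReal) < rG)
    (hS : ScaleBounds G μ d α w x₀ C₁ C₂ R R) (y : V) :
    ∑ z ∈ ballFinset h y R, localized G w x₀ R y z / (G.dist y z : ℝ) ^ (d + α) *
        (G.dist y z : ℝ) ^ 2 * μ z ≤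
      (cM * C₁ + 2 ^ (d + α) * cG / (1 - 2 ^ (-(2 - α)))) * R ^ (2 - α) := by
  have hμ := h.mass_pos hcM
  have h1 := sum_ball_rpow_le h hd hα hα2 hcM hcG y (by linarith : 0 < R) hRG
  by_cases hy : y ∈ ball G x₀ (3 * R)
  · have h2 := hS.second_moment y hy
    rw [tsum_subtype_eq_sum (finite_ball h y R)
      fun z => w y z / (G.dist y z : ℝ) ^ (d + α - 2)] at h2
    have h3 : ∀ z, localized G w x₀ R y z / (G.dist y z : ℝ) ^ (d + α) *
        (G.dist y z : ℝ) ^ 2 * μ z ≤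
        cM * (w y z / (G.dist y z : ℝ) ^ (d + α - 2)) +
          1 / (G.dist y z : ℝ) ^ (d + α) * (G.dist y z : ℝ) ^ 2 * μ z := by
      intro z
      have p1 : 0 ≤ cM * (w y z / (G.dist y z : ℝ) ^ (d + α - 2)) :=
        mul_nonneg (by linarith) (div_nonneg (hw.nonneg y z) (by positivity))
      have p2 : 0 ≤ 1 / (G.dist y z : ℝ) ^ (d + α) * (G.dist y z : ℝ) ^ 2 * μ z :=
        mul_nonneg (by positivity) (hμ z).le
      rcases localized_eq_or (G := G) (w := w) (x₀ := x₀) (R := R) y z with e | e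
      · rw [e]
        -- The powers of the distance cannot be merged on the diagonal; there `w` vanishes.
        rcases Nat.eq_zero_or_pos (G.dist y z) with h0 | h0
        · have : w y z = 0 := by
            rw [← (h.connected.dist_eq_zero_iff).1 h0]; exact hw.diag y
          rw [this] at p1 ⊢
          simp only [zero_div, zero_mul, mul_zero, zero_add] at p1 ⊢
          exact p2
        · have h0' : (0 : ℝ) < G.dist y z := by exact_mod_cast h0
          have e2 : w y z / (G.dist y z : ℝ) ^ (d + α) * (G.dist y z : ℝ) ^ 2 =
              w y z / (G.dist y z : ℝ) ^ (d + α - 2) := by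
            rw [Real.rpow_sub h0']
            norm_num
            field_simp
          rw [e2]
          have := mul_le_mul_of_nonneg_left (h.mass_point_le z)
            (div_nonneg (hw.nonneg y z) (show 0 ≤ (G.dist y z : ℝ) ^ (d + α - 2) by positivity))
          linarith
      · rw [e]; linarith
    refine (Finset.sum_le_sum fun z _ => h3 z).trans ?_
    rw [Finset.sum_add_distrib, ← Finset.mul_sum, add_mul]
    refine add_le_add ?_ h1
    rw [mul_assoc]
    exact mul_le_mul_of_nonneg_left h2 (by linarith)
  · have e : ∑ z ∈ ballFinset h y R, localized G w x₀ R y z / (G.dist y z : ℝ) ^ (d + α) *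
        (G.dist y z : ℝ) ^ 2 * μ z = ∑ z ∈ ballFinset h y R, 1 / (G.dist y z : ℝ) ^ (d + α) *
        (G.dist y z : ℝ) ^ 2 * μ z :=
      Finset.sum_congr rfl fun z hz => by
        rw [localized_eq_one h (by linarith) hy ((mem_ballFinset h).1 hz)]
    rw [e, add_mul]
    have : 0 ≤ cM * C₁ * R ^ (2 - α) := by positivity
    linarith

/-- The symmetric edge weights `μ_y μ_z v_{y,z} ρ(y, z) ^ (-(d + α))`, for `ρ(y, z) ≤ R`. -/
noncomputable def edgeWeight (G : SimpleGraph V) (μ : V → ℝ) (d α R : ℝ) (v : V → V → ℝ)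
    (y z : V) : ℝ :=
  if (G.dist y z : ℝ) ≤ R then μ y * (v y z / (G.dist y z : ℝ) ^ (d + α) * μ z) else 0

lemma edgeWeight_symm {v : V → V → ℝ} (hv : ∀ y z, v y z = v z y) (y z : V) :
    edgeWeight G μ d α R v y z = edgeWeight G μ d α R v z y := by
  unfold edgeWeight
  rw [SimpleGraph.dist_comm (u := z), hv z y]
  split_ifs
  · ring
  · rfl

lemma edgeWeight_nonneg {v : V → V → ℝ} (hμ : ∀ y, 0 < μ y) (hv : ∀ y z, 0 ≤ v y z) (y z : V) :
    0 ≤ edgeWeight G μ d α R v y z := by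
  unfold edgeWeight
  split_ifs
  · exact mul_nonneg (hμ y).le (mul_nonneg (div_nonneg (hv y z) (by positivity)) (hμ z).le)
  · exact le_rfl

lemma edgeWeight_eq_zero (h : IsDSetGraph G μ d cM cG rG) {v : V → V → ℝ} {y z : V}
    (hz : z ∉ ballFinset h y R) : edgeWeight G μ d α R v y z = 0 := by
  rw [mem_ballFinset] at hz
  rw [edgeWeight, if_neg hz]

lemma summable_edgeWeight_mul (h : IsDSetGraph G μ d cM cG rG) {v : V → V → ℝ} (y : V)
    (f : V → ℝ) : Summable fun z => edgeWeight G μ d α R v y z * f z :=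
  summable_of_ne_finset_zero (s := ballFinset h y R) fun z hz => by
    rw [edgeWeight_eq_zero h hz, zero_mul]

lemma tsum_edgeWeight_mul (h : IsDSetGraph G μ d cM cG rG) {v : V → V → ℝ} (y : V)
    (f : V → ℝ) : ∑' z, edgeWeight G μ d α R v y z * f z =
      μ y * ∑ z ∈ ballFinset h y R, v y z / (G.dist y z : ℝ) ^ (d + α) * μ z * f z := by
  rw [tsum_eq_sum (s := ballFinset h y R) fun z hz => by
    rw [edgeWeight_eq_zero h hz, zero_mul], Finset.mul_sum]
  refine Finset.sum_congr rfl fun z hz => ?_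
  rw [edgeWeight, if_pos ((mem_ballFinset h).1 hz), mul_assoc]

/-- Distinct vertices are at distance at least one, so the second moment also bounds the jump rate.
-/
lemma tsum_edgeWeight_le (h : IsDSetGraph G μ d cM cG rG) {v : V → V → ℝ} {D : ℝ}
    (hcM : 1 ≤ cM) (hdα : 0 < d + α) (hv : ∀ y z, 0 ≤ v y z)
    (hD : ∀ y, ∑ z ∈ ballFinset h y R, v y z / (G.dist y z : ℝ) ^ (d + α) *
        (G.dist y z : ℝ) ^ 2 * μ z ≤ D) (y : V) :
    ∑' z, edgeWeight G μ d α R v y z ≤ D * μ y := by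
  have hμ := h.mass_pos hcM
  have e := tsum_edgeWeight_mul (α := α) (R := R) h (v := v) y fun _ => 1
  simp only [mul_one] at e
  rw [e, mul_comm]
  refine mul_le_mul_of_nonneg_right (le_trans (Finset.sum_le_sum fun z _ => ?_) (hD y)) (hμ y).le
  refine mul_le_mul_of_nonneg_right ?_ (hμ z).le
  rcases Nat.eq_zero_or_pos (G.dist y z) with h0 | h0
  · simp [h0, Real.zero_rpow hdα.ne']
  · have h1 : (1 : ℝ) ≤ G.dist y z := by exact_mod_cast h0
    exact le_mul_of_one_le_right (div_nonneg (hv y z) (by positivity)) (one_le_pow₀ h1)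

lemma sum_gradient_le (h : IsDSetGraph G μ d cM cG rG) {v : V → V → ℝ} {D : ℝ}
    (hcM : 1 ≤ cM) (hv : ∀ y z, 0 ≤ v y z)
    (hD : ∀ y, ∑ z ∈ ballFinset h y R, v y z / (G.dist y z : ℝ) ^ (d + α) *
        (G.dist y z : ℝ) ^ 2 * μ z ≤ D) (x y : V) :
    ∑' z, edgeWeight G μ d α R v y z * ((G.dist x y : ℝ) - G.dist x z) ^ 2 ≤ D * μ y := by
  have hμ := h.mass_pos hcM
  rw [tsum_edgeWeight_mul h, mul_comm]
  refine mul_le_mul_of_nonneg_right (le_trans (Finset.sum_le_sum fun z _ => ?_) (hD y)) (hμ y).le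
  rw [mul_right_comm]
  refine mul_le_mul_of_nonneg_right ?_ (hμ z).le
  refine mul_le_mul_of_nonneg_left ?_ (div_nonneg (hv y z) (by positivity))
  have t1 : (G.dist x y : ℝ) ≤ G.dist x z + G.dist z y := by
    exact_mod_cast h.connected.dist_triangle
  have t2 : (G.dist x z : ℝ) ≤ G.dist x y + G.dist y z := by
    exact_mod_cast h.connected.dist_triangle
  rw [SimpleGraph.dist_comm (u := z)] at t1
  refine sq_le_sq' ?_ ?_ <;> linarith

/-- The truncated distance is constant far from `x` and jumps have length at most `R`, so only
finitely many pairs contribute. -/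
lemma summable_truncated_dist (h : IsDSetGraph G μ d cM cG rG) {v : V → V → ℝ} (x : V) (N : ℕ) :
    Summable fun q : V × V => edgeWeight G μ d α R v q.1 q.2 *
      (((min (G.dist x q.1) N : ℕ) : ℝ) - ((min (G.dist x q.2) N : ℕ) : ℝ)) ^ 2 := by
  refine summable_of_ne_finset_zero
    (s := ballFinset h x (N + R) ×ˢ ballFinset h x (N + R)) fun q hq => ?_
  by_cases hR : (G.dist q.1 q.2 : ℝ) ≤ R
  · have h2 : N ≤ G.dist x q.1 ∧ N ≤ G.dist x q.2 := by
      by_contra hcon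
      apply hq
      rw [Finset.mem_product, mem_ballFinset, mem_ballFinset]
      have t1 : (G.dist x q.1 : ℝ) ≤ G.dist x q.2 + G.dist q.2 q.1 := by
        exact_mod_cast h.connected.dist_triangle
      have t2 : (G.dist x q.2 : ℝ) ≤ G.dist x q.1 + G.dist q.1 q.2 := by
        exact_mod_cast h.connected.dist_triangle
      rw [SimpleGraph.dist_comm (u := q.2)] at t1
      have t0 : (0 : ℝ) ≤ G.dist q.1 q.2 := Nat.cast_nonneg _
      rcases not_and_or.1 hcon with h3 | h3
      · have h3' : (G.dist x q.1 : ℝ) ≤ N := by exact_mod_cast (not_le.1 h3).le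
        constructor <;> linarith
      · have h3' : (G.dist x q.2 : ℝ) ≤ N := by exact_mod_cast (not_le.1 h3).le
        constructor <;> linarith
    rw [min_eq_right h2.1, min_eq_right h2.2]; simp
  · rw [edgeWeight, if_neg hR, zero_mul]

/-- Pointwise comparison of a function with its averages over the sets `P`. -/
lemma mul_sq_le_average (h : IsDSetGraph G μ d cM cG rG) {v : V → V → ℝ} {a b : ℝ} {P : Finset V}
    {y : V} {f : V → ℝ} (hcM : 1 ≤ cM) (hdα : 0 < d + α) (hv : ∀ z, 0 ≤ v y z) (ha : 0 < a)
    (hr : 1 ≤ r) (hrR : r ≤ R) (hP : ∀ z ∈ P, (G.dist y z : ℝ) ≤ r ∧ 0 < v y z)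
    (hPm : a * r ^ d ≤ ∑ z ∈ P, μ z) (hPi : ∑ z ∈ P, (v y z)⁻¹ ≤ b * r ^ d)
    (hf : ∀ z, 0 ≤ f z) (hf1 : ∑ z ∈ P, μ z * f z ≤ 1) :
    μ y * (f y * f y) ≤ cM * b / a ^ 2 * r ^ α *
      ∑' z, edgeWeight G μ d α R v y z * (f y - f z) ^ 2 + 2 / a * r ^ (-d) * (μ y * f y) := by
  have hμ := h.mass_pos hcM
  have hr0 : 0 < r := by linarith
  rw [tsum_edgeWeight_mul h]
  set E := ∑ z ∈ ballFinset h y R, v y z / (G.dist y z : ℝ) ^ (d + α) * μ z * (f y - f z) ^ 2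
    with hE
  set m := ∑ z ∈ P, μ z with hm
  have hterm : ∀ z, 0 ≤ v y z / (G.dist y z : ℝ) ^ (d + α) * μ z * (f y - f z) ^ 2 := fun z =>
    mul_nonneg (mul_nonneg (div_nonneg (hv z) (by positivity)) (hμ z).le) (sq_nonneg _)
  have hE0 : 0 ≤ E := Finset.sum_nonneg fun z _ => hterm z
  have ham : 0 < a * r ^ d := by positivity
  have hm0 : 0 < m := ham.trans_le hPm
  set g := (∑ z ∈ P, μ z * f z) / m with hg
  have hg1 : g ≤ 1 / (a * r ^ d) := by
    rw [hg]
    exact (div_le_div_of_nonneg_right hf1 hm0.le).trans (one_div_le_one_div_of_le ham hPm)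
  have hdiff : (f y - g) * m = ∑ z ∈ P, (f y - f z) * μ z := by
    rw [sub_mul, hg, div_mul_cancel₀ _ hm0.ne', hm, Finset.mul_sum, ← Finset.sum_sub_distrib]
    exact Finset.sum_congr rfl fun z _ => by ring
  -- Cauchy-Schwarz, splitting the weight into the kernel and its inverse, with `ρ(y, z) ≤ r` on
  -- `P`. Dividing by `m ^ 2 ≥ (a r ^ d) ^ 2` leaves `r ^ (d + α + d - 2 d) = r ^ α`.
  have hcs : ((f y - g) * m) ^ 2 ≤ E * (r ^ (d + α) * cM * (b * r ^ d)) := by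
    rw [hdiff]
    have h1 := Finset.sum_sq_le_sum_mul_sum_of_sq_le_mul P
      (r := fun z => (f y - f z) * μ z)
      (f := fun z => v y z / (G.dist y z : ℝ) ^ (d + α) * μ z * (f y - f z) ^ 2)
      (g := fun z => r ^ (d + α) * (v y z)⁻¹ * μ z) (fun z _ => hterm z)
      (fun z hz => mul_nonneg (mul_nonneg (by positivity) (inv_nonneg.2 (hv z))) (hμ z).le)
      (fun z hz => by
        obtain ⟨hz1, hz2⟩ := hP z hz
        rcases Nat.eq_zero_or_pos (G.dist y z) with h0 | h0
        · rw [(h.connected.dist_eq_zero_iff).1 h0]; simp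
        · have h0' : (0 : ℝ) < G.dist y z := by exact_mod_cast h0
          have h1 : (G.dist y z : ℝ) ^ (d + α) ≤ r ^ (d + α) :=
            Real.rpow_le_rpow h0'.le hz1 hdα.le
          have h2 : 1 ≤ r ^ (d + α) / (G.dist y z : ℝ) ^ (d + α) := by
            rwa [one_le_div (by positivity)]
          have e : v y z / (G.dist y z : ℝ) ^ (d + α) * μ z * (f y - f z) ^ 2 *
              (r ^ (d + α) * (v y z)⁻¹ * μ z) =
              ((f y - f z) * μ z) ^ 2 * (r ^ (d + α) / (G.dist y z : ℝ) ^ (d + α)) := by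
            field_simp
          rw [e]
          exact le_mul_of_one_le_right (sq_nonneg _) h2)
    refine h1.trans (mul_le_mul ?_ ?_ (Finset.sum_nonneg fun z _ =>
      mul_nonneg (mul_nonneg (by positivity) (inv_nonneg.2 (hv z))) (hμ z).le) hE0)
    · exact Finset.sum_le_sum_of_subset_of_nonneg
        (fun z hz => (mem_ballFinset h).2 ((hP z hz).1.trans hrR)) fun z _ _ => hterm z
    · refine le_trans (Finset.sum_le_sum fun z _ => mul_le_mul_of_nonneg_left
        (h.mass_point_le z) (mul_nonneg (by positivity) (inv_nonneg.2 (hv z)))) ?_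
      rw [← Finset.sum_mul, ← Finset.mul_sum, mul_right_comm]
      exact mul_le_mul_of_nonneg_left hPi (mul_nonneg (by positivity) (by linarith))
  have hsq : (f y - g) ^ 2 ≤ cM * b / a ^ 2 * r ^ α * E := by
    have h1 : (f y - g) ^ 2 * (a * r ^ d) ^ 2 ≤ ((f y - g) * m) ^ 2 := by
      rw [mul_pow (f y - g)]
      exact mul_le_mul_of_nonneg_left (pow_le_pow_left₀ ham.le hPm 2) (sq_nonneg _)
    have h2 : E * (r ^ (d + α) * cM * (b * r ^ d)) =
        cM * b / a ^ 2 * r ^ α * E * (a * r ^ d) ^ 2 := by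
      rw [Real.rpow_add hr0]; field_simp
    rw [h2] at hcs
    exact le_of_mul_le_mul_right (h1.trans hcs) (by positivity)
  -- From `f² ≤ (f - g)² + 2 f g`: the cross term stays linear in `f`, hence summable over `y` with
  -- total mass one.
  have hfin : f y * f y ≤ cM * b / a ^ 2 * r ^ α * E + 2 / a * r ^ (-d) * f y := by
    have h1 : 2 * f y * g ≤ 2 * f y * (1 / (a * r ^ d)) :=
      mul_le_mul_of_nonneg_left hg1 (by linarith [hf y])
    have h2 : 2 * f y * (1 / (a * r ^ d)) = 2 / a * r ^ (-d) * f y := by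
      rw [Real.rpow_neg hr0.le]; field_simp
    nlinarith [sq_nonneg g]
  have := mul_le_mul_of_nonneg_left hfin (hμ y).le
  linarith

end Conductance

/-! ### The `L²` norm and the Nash inequality along the flow. -/

namespace HeatFlow

variable {V : Type*} {μ : V → ℝ} {k : V → V → ℝ} {c lam : ℝ} {x : V} {p : ℝ → V → ℝ}

lemma summable_dirichlet (h : HeatFlow μ k c lam x p) {t : ℝ} (ht : 0 ≤ t) :
    Summable fun q : V × V => k q.1 q.2 * (p t q.1 - p t q.2) ^ 2 := by
  refine h.summable_bdd_mul ht (B := 2 * c) fun q => ?_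
  rw [abs_of_nonneg (sq_nonneg _), ← sq_abs, sq]
  refine mul_le_mul ?_ (h.abs_sub_le ht _ _) (abs_nonneg _) (by linarith [h.c_pos])
  linarith [h.abs_sub_le ht q.1 q.2, h.le_c ht q.1, h.le_c ht q.2]

lemma summable_sq (h : HeatFlow μ k c lam x p) {t : ℝ} (ht : 0 ≤ t) :
    Summable fun y => μ y * (p t y * p t y) :=
  h.summable_mean (g := p t) (N := c)
    (fun y => by rw [abs_of_nonneg (h.nonneg t ht y)]; exact h.le_c ht y) ht

lemma tsum_sq_le (h : HeatFlow μ k c lam x p) {t : ℝ} (ht : 0 ≤ t) :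
    ∑' y, μ y * (p t y * p t y) ≤ c := by
  have h1 : c = ∑' y, c * (μ y * p t y) := by
    rw [tsum_mul_left, (h.hasSum t ht).tsum_eq, mul_one]
  conv_rhs => rw [h1]
  refine (h.summable_sq ht).tsum_le_tsum (fun y => ?_) ((h.hasSum t ht).summable.mul_left _)
  have := mul_le_mul_of_nonneg_right (h.le_c ht y) (h.mul_nonneg' ht y)
  linarith

lemma sq_bound {c : ℝ} : ∀ a, 0 ≤ a → a ≤ c → |2 * a| ≤ 2 * c := fun a ha hac => by
  rw [abs_of_nonneg (by linarith)]; linarith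

lemma hasDerivAt_sq_id (a : ℝ) : HasDerivAt (fun a : ℝ => a * a) (2 * a) a := by
  have := (hasDerivAt_id a).mul (hasDerivAt_id a)
  refine this.congr_deriv ?_
  simp; ring

lemma continuousOn_tsum_sq (h : HeatFlow μ k c lam x p) :
    ContinuousOn (fun t => ∑' y, μ y * (p t y * p t y)) (Ici 0) :=
  h.continuousOn_functional (Φ := fun _ a => a * a) (φ := fun _ a => 2 * a)
    (fun _ => mul_zero _) (fun _ a _ => hasDerivAt_sq_id a) (fun _ => sq_bound)

lemma hasDerivAt_tsum_sq (h : HeatFlow μ k c lam x p) {t : ℝ} (ht : 0 < t) :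
    HasDerivAt (fun t => ∑' y, μ y * (p t y * p t y))
      (-∑' q : V × V, k q.1 q.2 * (p t q.1 - p t q.2) ^ 2) t := by
  refine (h.hasDerivAt_functional (Φ := fun _ a => a * a) (φ := fun _ a => 2 * a)
    (fun _ => mul_zero _) (fun _ a _ => hasDerivAt_sq_id a) (fun _ => sq_bound) ht).congr_deriv ?_
  rw [← tsum_mul_left, ← tsum_neg]
  exact tsum_congr fun q => by ring

lemma nash_of_pointwise (h : HeatFlow μ k c lam x p) {t a b : ℝ} (ht : 0 ≤ t)
    (hp : ∀ y, μ y * (p t y * p t y) ≤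
      a * ∑' z, k y z * (p t y - p t z) ^ 2 + b * (μ y * p t y)) :
    ∑' y, μ y * (p t y * p t y) ≤
      a * (∑' q : V × V, k q.1 q.2 * (p t q.1 - p t q.2) ^ 2) + b := by
  have s1 := h.summable_dirichlet ht
  have s2 := (h.hasSum t ht).summable
  refine ((h.summable_sq ht).tsum_le_tsum hp
    ((s1.prod.mul_left a).add (s2.mul_left b))).trans (le_of_eq ?_)
  rw [(s1.prod.mul_left a).tsum_add (s2.mul_left b), tsum_mul_left, tsum_mul_left,
    (h.hasSum t ht).tsum_eq, mul_one, s1.tsum_prod]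

end HeatFlow

open MeasureTheory

/-! ### From the martingale problem to the Kolmogorov forward equation. -/

section JumpProcess

lemma integrable_comp_and_hasSum {V Ω : Type*} [Countable V] [MeasurableSpace Ω] {P : Measure Ω}
    [IsProbabilityMeasure P] {Y : Ω → V} (hY : ∀ y, MeasurableSet {ω | Y ω = y}) {g : V → ℝ}
    (hg : Summable fun y => P.real {ω | Y ω = y} * |g y|) :
    Integrable (fun ω => g (Y ω)) P ∧
      HasSum (fun y => P.real {ω | Y ω = y} * g y) (∫ ω, g (Y ω) ∂P) := by
  let _ : MeasurableSpace V := ⊤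
  have hYm : Measurable Y := measurable_to_countable' fun y => hY y
  have hmap : ∀ y, P.map Y {y} = P {ω | Y ω = y} := fun y =>
    Measure.map_apply hYm (measurableSet_singleton y)
  have hreal : ∀ y, (P.map Y {y}).toReal = P.real {ω | Y ω = y} := fun y => by
    rw [hmap, measureReal_def]
  have hc : ∀ y, P.map Y {y} ≠ ⊤ := fun y => by rw [hmap]; exact measure_ne_top _ _
  have hf : Summable fun y => (P.map Y {y}).toReal * ‖g y‖ :=
    hg.congr fun y => by rw [hreal, Real.norm_eq_abs]
  have hi := integrable_sum_dirac (x := fun y : V => y) hc hf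
  have hs := hasSum_integral_sum_dirac (x := fun y : V => y) hc hf
  rw [Measure.sum_smul_dirac] at hi hs
  rw [integral_map hYm.aemeasurable hi.aestronglyMeasurable] at hs
  refine ⟨(integrable_map_measure hi.aestronglyMeasurable hYm.aemeasurable).1 hi, ?_⟩
  simpa only [hreal, smul_eq_mul] using hs

/-- An approximation of `s` from the right. -/
noncomputable def rightApprox (n : ℕ) (s : NNReal) : NNReal := (⌊(n + 1) * s⌋₊ + 1) / (n + 1)

lemma tendsto_rightApprox (s : NNReal) :
    Tendsto (fun n => rightApprox n s) atTop (𝓝[>] s) := by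
  have hlt : ∀ n, s < rightApprox n s := fun n => by
    unfold rightApprox
    rw [lt_div_iff₀ (by positivity), mul_comm]
    exact Nat.lt_floor_add_one _
  have hle : ∀ n, rightApprox n s ≤ s + 1 / ((n : NNReal) + 1) := fun n => by
    unfold rightApprox
    rw [add_div]
    refine add_le_add ?_ le_rfl
    rw [div_le_iff₀ (by positivity), mul_comm s]
    exact Nat.floor_le (by positivity)
  refine tendsto_nhdsWithin_iff.2 ⟨?_, Eventually.of_forall hlt⟩
  refine tendsto_of_tendsto_of_tendsto_of_le_of_le tendsto_const_nhds ?_ (fun n => (hlt n).le) hle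
  have : Tendsto (fun n : ℕ => 1 / ((n : NNReal) + 1)) atTop (𝓝 0) :=
    tendsto_one_div_add_atTop_nhds_zero_nat
  simpa using this.const_add s

open Classical in
/-- The indicator function of a point. -/
noncomputable def pointIndicator {V : Type*} (y z : V) : ℝ := if z = y then 1 else 0

lemma pointIndicator_self {V : Type*} (y : V) : pointIndicator y y = 1 := if_pos rfl

lemma pointIndicator_of_ne {V : Type*} {y z : V} (h : z ≠ y) : pointIndicator y z = 0 := if_neg h

lemma abs_pointIndicator_le {V : Type*} (y z : V) : ‖pointIndicator y z‖ ≤ 1 := by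
  unfold pointIndicator
  split_ifs <;> simp

lemma measurable_pointIndicator_comp {V Ω : Type*} [MeasurableSpace Ω] {Y : Ω → V} {y : V}
    (hY : MeasurableSet {ω | Y ω = y}) : Measurable fun ω => pointIndicator y (Y ω) :=
  Measurable.ite hY measurable_const measurable_const

variable {V Ω : Type*} [mΩ : MeasurableSpace Ω] {X : NNReal → Ω → V}

/-- By right-continuity the path is a limit of step processes sampled at grid times just after `s`,
whose level sets are countable unions of measurable rectangles. Joint measurability is what Fubini
requires below. -/
lemma measurable_uncurry_pointIndicator (hX : ∀ t y, MeasurableSet {ω | X t ω = y})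
    (hrc : ∀ ω t, ∀ᶠ s in 𝓝[>] t, X s ω = X t ω) (y : V) :
    Measurable fun q : NNReal × Ω => pointIndicator y (X q.1 q.2) := by
  refine measurable_of_tendsto_metrizable
    (f := fun n (q : NNReal × Ω) => pointIndicator y (X (rightApprox n q.1) q.2)) ?_ ?_
  · intro n
    refine measurable_pointIndicator_comp (Y := fun q : NNReal × Ω => X (rightApprox n q.1) q.2) ?_
    have e : {q : NNReal × Ω | X (rightApprox n q.1) q.2 = y} =
        ⋃ j : ℕ, ((fun s : NNReal => ⌊(n + 1) * s⌋₊) ⁻¹' {j}) ×ˢ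
          {ω | X (((j : NNReal) + 1) / (n + 1)) ω = y} := by
      ext ⟨s, ω⟩
      simp only [mem_ofPred_eq, mem_iUnion, mem_prod, mem_preimage, mem_singleton_iff, rightApprox]
      constructor
      · intro h; exact ⟨_, rfl, h⟩
      · rintro ⟨j, rfl, h⟩; exact h
    rw [e]
    refine MeasurableSet.iUnion fun j => MeasurableSet.prod ?_ (hX _ _)
    have hm : Measurable fun s : NNReal => ⌊(n + 1) * s⌋₊ :=
      Nat.measurable_floor.comp (measurable_const.mul measurable_id)
    exact hm (measurableSet_singleton j)
  · rw [tendsto_pi_nhds]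
    intro q
    refine tendsto_const_nhds.congr' ?_
    filter_upwards [(tendsto_rightApprox q.1).eventually (hrc q.2 q.1)] with n hn
    rw [hn]

variable {P : Measure Ω}

lemma integral_pointIndicator (hX : ∀ t y, MeasurableSet {ω | X t ω = y}) (t : NNReal) (y : V) :
    ∫ ω, pointIndicator y (X t ω) ∂P = P.real {ω | X t ω = y} := by
  have : (fun ω => pointIndicator y (X t ω)) = {ω | X t ω = y}.indicator 1 := by
    ext ω
    by_cases h : X t ω = y
    · rw [indicator_of_mem (show ω ∈ {ω | X t ω = y} from h), h, pointIndicator_self]; rfl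
    · rw [indicator_of_notMem (show ω ∉ {ω | X t ω = y} from h), pointIndicator_of_ne h]
  rw [this, integral_indicator_one (hX t y)]

variable [IsProbabilityMeasure P]

lemma integrable_pointIndicator (hX : ∀ t y, MeasurableSet {ω | X t ω = y}) (t : NNReal) (y : V) :
    Integrable (fun ω => pointIndicator y (X t ω)) P :=
  Integrable.of_bound (measurable_pointIndicator_comp (hX t y)).aestronglyMeasurable 1
    (Eventually.of_forall fun _ => abs_pointIndicator_le _ _)

lemma measurable_prob (hX : ∀ t y, MeasurableSet {ω | X t ω = y})
    (hrc : ∀ ω t, ∀ᶠ s in 𝓝[>] t, X s ω = X t ω) (y : V) :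
    Measurable fun s : ℝ => P.real {ω | X s.toNNReal ω = y} := by
  have h1 : StronglyMeasurable fun s : NNReal => ∫ ω, pointIndicator y (X s ω) ∂P :=
    (measurable_uncurry_pointIndicator hX hrc y).stronglyMeasurable.integral_prod_right
  simp only [integral_pointIndicator hX] at h1
  exact h1.measurable.comp measurable_real_toNNReal

lemma integral_intervalIntegral_pointIndicator (hX : ∀ t y, MeasurableSet {ω | X t ω = y})
    (hrc : ∀ ω t, ∀ᶠ s in 𝓝[>] t, X s ω = X t ω) (y : V) {t : ℝ} (ht : 0 ≤ t) :
    Integrable (fun ω => ∫ s in (0 : ℝ)..t, pointIndicator y (X s.toNNReal ω)) P ∧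
    ∫ ω, (∫ s in (0 : ℝ)..t, pointIndicator y (X s.toNNReal ω)) ∂P =
      ∫ s in (0 : ℝ)..t, P.real {ω | X s.toNNReal ω = y} := by
  have hm : Measurable fun q : Ω × ℝ => pointIndicator y (X q.2.toNNReal q.1) :=
    (measurable_uncurry_pointIndicator hX hrc y).comp
      ((measurable_real_toNNReal.comp measurable_snd).prodMk measurable_fst)
  have hi : Integrable (Function.uncurry fun ω (s : ℝ) => pointIndicator y (X s.toNNReal ω))
      (P.prod (volume.restrict (Ioc 0 t))) :=
    Integrable.of_bound hm.aestronglyMeasurable 1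
      (Eventually.of_forall fun _ => abs_pointIndicator_le _ _)
  simp only [intervalIntegral.integral_of_le ht]
  refine ⟨hi.integral_prod_left, ?_⟩
  rw [integral_integral_swap hi]
  simp only [integral_pointIndicator hX]

lemma intervalIntegrable_pointIndicator (hX : ∀ t y, MeasurableSet {ω | X t ω = y})
    (hrc : ∀ ω t, ∀ᶠ s in 𝓝[>] t, X s ω = X t ω) (y : V) (ω : Ω) (a b : ℝ) :
    IntervalIntegrable (fun s : ℝ => pointIndicator y (X s.toNNReal ω)) volume a b := by
  have hm : Measurable fun s : ℝ => pointIndicator y (X s.toNNReal ω) :=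
    (measurable_uncurry_pointIndicator hX hrc y).comp
      (measurable_real_toNNReal.prodMk measurable_const)
  refine (intervalIntegrable_const (c := (1 : ℝ))).mono_fun hm.aestronglyMeasurable ?_
  refine Eventually.of_forall fun s => ?_
  simpa using abs_pointIndicator_le y (X s.toNNReal ω)

lemma intervalIntegrable_prob (hX : ∀ t y, MeasurableSet {ω | X t ω = y})
    (hrc : ∀ ω t, ∀ᶠ s in 𝓝[>] t, X s ω = X t ω) (y : V) (a b : ℝ) :
    IntervalIntegrable (fun s : ℝ => P.real {ω | X s.toNNReal ω = y}) volume a b := by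
  refine (intervalIntegrable_const (c := (1 : ℝ))).mono_fun
    (measurable_prob hX hrc y).aestronglyMeasurable ?_
  refine Eventually.of_forall fun s => ?_
  dsimp only
  rw [Real.norm_of_nonneg measureReal_nonneg, norm_one]
  exact measureReal_le_one

/-- The Kolmogorov forward equation in integrated form, for a generator which maps the indicator
of `y` to a function supported in `F`. -/
lemma IsJumpProcess.forward_eq {L : (V → ℝ) → V → ℝ} {x : V} {𝓕 : Filtration NNReal mΩ}
    (h : IsJumpProcess L x P 𝓕 X) {y : V} {F : Finset V}
    (hF : ∀ z ∉ F, L (pointIndicator y) z = 0) {t : ℝ} (ht : 0 ≤ t) :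
    P.real {ω | X t.toNNReal ω = y} = P.real {ω | X 0 ω = y} +
      ∫ s in (0 : ℝ)..t, ∑ u ∈ F, L (pointIndicator y) u * P.real {ω | X s.toNNReal ω = u} := by
  have hX : ∀ t y, MeasurableSet {ω | X t ω = y} := fun t y => 𝓕.le t _ (h.adapted t y)
  have hrc := h.right_continuous
  have hsupp : (Function.support (pointIndicator y)).Finite :=
    (Set.finite_singleton y).subset fun z hz => by
      by_contra hne
      exact hz (pointIndicator_of_ne hne)
  have hL : ∀ z, L (pointIndicator y) z = ∑ u ∈ F, L (pointIndicator y) u * pointIndicator u z := by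
    intro z
    by_cases hz : z ∈ F
    · rw [Finset.sum_eq_single z (fun u _ hu => by rw [pointIndicator_of_ne hu.symm, mul_zero])
        (fun hz' => absurd hz hz'), pointIndicator_self, mul_one]
    · rw [hF z hz]
      refine (Finset.sum_eq_zero fun u hu => ?_).symm
      rw [pointIndicator_of_ne (fun e : z = u => hz (e ▸ hu)), mul_zero]
  have hpath : ∀ ω, ∫ s in (0 : ℝ)..t, L (pointIndicator y) (X s.toNNReal ω) =
      ∑ u ∈ F, L (pointIndicator y) u *
        ∫ s in (0 : ℝ)..t, pointIndicator u (X s.toNNReal ω) := by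
    intro ω
    have : ∀ s : ℝ, L (pointIndicator y) (X s.toNNReal ω) =
        ∑ u ∈ F, L (pointIndicator y) u * pointIndicator u (X s.toNNReal ω) := fun s => hL _
    simp only [this]
    rw [intervalIntegral.integral_finsetSum fun u _ =>
      (intervalIntegrable_pointIndicator hX hrc u ω 0 t).const_mul _]
    exact Finset.sum_congr rfl fun u _ => intervalIntegral.integral_const_mul _ _
  have hint : ∀ u ∈ F, Integrable (fun ω => L (pointIndicator y) u *
      ∫ s in (0 : ℝ)..t, pointIndicator u (X s.toNNReal ω)) P := fun u _ =>
    ((integral_intervalIntegral_pointIndicator hX hrc u ht).1).const_mul _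
  -- The expectation of the martingale is constant in time and vanishes at time `0`.
  have hmart := (h.martingale _ hsupp).setIntegral_eq (zero_le : 0 ≤ t.toNNReal) MeasurableSet.univ
  simp only [Measure.restrict_univ, NNReal.coe_zero, intervalIntegral.integral_same, sub_self,
    integral_zero, Real.coe_toNNReal t ht, hpath] at hmart
  have hint0 : Integrable (fun ω => pointIndicator y (X t.toNNReal ω) -
      pointIndicator y (X 0 ω)) P :=
    (integrable_pointIndicator hX _ y).sub (integrable_pointIndicator hX _ y)
  rw [integral_sub hint0 (integrable_finsetSum _ hint),
    integral_sub (integrable_pointIndicator hX _ y) (integrable_pointIndicator hX _ y),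
    integral_pointIndicator hX, integral_pointIndicator hX, integral_finsetSum _ hint] at hmart
  rw [intervalIntegral.integral_finsetSum fun u _ =>
      (intervalIntegrable_prob hX hrc u 0 t).const_mul _]
  have e : ∀ u ∈ F, ∫ ω, L (pointIndicator y) u *
      (∫ s in (0 : ℝ)..t, pointIndicator u (X s.toNNReal ω)) ∂P =
      ∫ s in (0 : ℝ)..t, L (pointIndicator y) u * P.real {ω | X s.toNNReal ω = u} := fun u _ => by
    rw [integral_const_mul, (integral_intervalIntegral_pointIndicator hX hrc u ht).2,
      intervalIntegral.integral_const_mul]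
  rw [Finset.sum_congr rfl e] at hmart
  linarith

lemma IsJumpProcess.continuousOn_prob {L : (V → ℝ) → V → ℝ} {x : V} {𝓕 : Filtration NNReal mΩ}
    (h : IsJumpProcess L x P 𝓕 X) {y : V} {F : Finset V}
    (hF : ∀ z ∉ F, L (pointIndicator y) z = 0) :
    ContinuousOn (fun t : ℝ => P.real {ω | X t.toNNReal ω = y}) (Ici 0) := by
  have hX : ∀ t y, MeasurableSet {ω | X t ω = y} := fun t y => 𝓕.le t _ (h.adapted t y)
  refine ContinuousOn.congr (f := fun t => P.real {ω | X 0 ω = y} +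
    ∫ s in (0 : ℝ)..t, ∑ u ∈ F, L (pointIndicator y) u * P.real {ω | X s.toNNReal ω = u})
    ?_ fun t ht => h.forward_eq hF ht
  refine (continuous_const.add (intervalIntegral.continuous_primitive (fun a b => ?_) 0)).continuousOn
  have := IntervalIntegrable.sum F (f := fun u (s : ℝ) =>
    L (pointIndicator y) u * P.real {ω | X s.toNNReal ω = u}) (a := a) (b := b) (μ := volume)
    fun u _ => (intervalIntegrable_prob hX h.right_continuous u a b).const_mul _
  refine this.congr ?_
  exact fun s _ => by simp

/-- A bootstrap: the integrated equation makes the probabilities continuous, so the integrand is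
continuous and the fundamental theorem of calculus applies. -/
lemma IsJumpProcess.hasDerivAt_prob {L : (V → ℝ) → V → ℝ} {x : V} {𝓕 : Filtration NNReal mΩ}
    (h : IsJumpProcess L x P 𝓕 X) {F : V → Finset V}
    (hF : ∀ y, ∀ z ∉ F y, L (pointIndicator y) z = 0) (y : V) {t : ℝ} (ht : 0 < t) :
    HasDerivAt (fun t : ℝ => P.real {ω | X t.toNNReal ω = y})
      (∑ u ∈ F y, L (pointIndicator y) u * P.real {ω | X t.toNNReal ω = u}) t := by
  have hX : ∀ t y, MeasurableSet {ω | X t ω = y} := fun t y => 𝓕.le t _ (h.adapted t y)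
  have hmeas : Measurable fun s : ℝ =>
      ∑ u ∈ F y, L (pointIndicator y) u * P.real {ω | X s.toNNReal ω = u} :=
    Finset.measurable_sum _ fun u _ =>
      (measurable_prob hX h.right_continuous u).const_mul _
  have hii : IntervalIntegrable (fun s : ℝ =>
      ∑ u ∈ F y, L (pointIndicator y) u * P.real {ω | X s.toNNReal ω = u}) volume 0 t := by
    have := IntervalIntegrable.sum (F y) (f := fun u (s : ℝ) =>
      L (pointIndicator y) u * P.real {ω | X s.toNNReal ω = u}) (a := 0) (b := t) (μ := volume)
      fun u _ => (intervalIntegrable_prob hX h.right_continuous u 0 t).const_mul _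
    exact this.congr fun s _ => by simp
  have hcont : ContinuousAt (fun s : ℝ =>
      ∑ u ∈ F y, L (pointIndicator y) u * P.real {ω | X s.toNNReal ω = u}) t := by
    refine tendsto_finsetSum _ fun u _ => Tendsto.const_mul _ ?_
    exact (h.continuousOn_prob (hF u)).continuousAt (Ici_mem_nhds ht)
  have key := (intervalIntegral.integral_hasDerivAt_right hii
    hmeas.stronglyMeasurable.stronglyMeasurableAtFilter hcont).const_add (P.real {ω | X 0 ω = y})
  refine key.congr_of_eventuallyEq ?_
  filter_upwards [Ioi_mem_nhds ht] with s hs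
  exact h.forward_eq (hF y) (le_of_lt hs)

end JumpProcess

/-! ### The density of the truncated process as a heat flow. -/

section Density

variable {V : Type*} {G : SimpleGraph V} {μ : V → ℝ} {d α cM cG R : ℝ} {rG : EReal}
  {v : V → V → ℝ}

lemma IsDSetGraph.countable (h : IsDSetGraph G μ d cM cG rG) (x : V) : Countable V := by
  rw [← Set.countable_univ_iff]
  have : (Set.univ : Set V) = ⋃ n : ℕ, ball G x n := by
    ext y
    simp only [mem_univ, mem_iUnion, true_iff]
    exact ⟨G.dist x y, le_refl (G.dist x y : ℝ)⟩
  rw [this]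
  exact Set.countable_iUnion fun n => (finite_ball h x n).countable

lemma truncatedGenerator_eq_sum (h : IsDSetGraph G μ d cM cG rG) (f : V → ℝ) (z : V) :
    truncatedGenerator G μ d α R v f z =
      ∑ u ∈ ballFinset h z R, (f u - f z) * (v z u / (G.dist z u : ℝ) ^ (d + α)) * μ u :=
  tsum_subtype_eq_sum (finite_ball h z R)
    fun u => (f u - f z) * (v z u / (G.dist z u : ℝ) ^ (d + α)) * μ u

lemma mem_ballFinset_comm (h : IsDSetGraph G μ d cM cG rG) {y z : V} :
    z ∈ ballFinset h y R ↔ y ∈ ballFinset h z R := by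
  rw [mem_ballFinset, mem_ballFinset, SimpleGraph.dist_comm]

lemma self_mem_ballFinset (h : IsDSetGraph G μ d cM cG rG) (hR : 0 ≤ R) (y : V) :
    y ∈ ballFinset h y R := by
  rw [mem_ballFinset, SimpleGraph.dist_self]; simpa

lemma truncatedGenerator_pointIndicator_of_notMem (h : IsDSetGraph G μ d cM cG rG) (hR : 0 ≤ R)
    {y z : V} (hz : z ∉ ballFinset h y R) :
    truncatedGenerator G μ d α R v (pointIndicator y) z = 0 := by
  rw [truncatedGenerator_eq_sum h]
  refine Finset.sum_eq_zero fun u hu => ?_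
  have h1 : u ≠ y := fun e => hz ((mem_ballFinset_comm h).2 (e ▸ hu))
  have h2 : z ≠ y := fun e => hz (e ▸ self_mem_ballFinset h hR z)
  rw [pointIndicator_of_ne h1, pointIndicator_of_ne h2]; simp

lemma truncatedGenerator_pointIndicator (h : IsDSetGraph G μ d cM cG rG)
    {y z : V} (hz : z ∈ ballFinset h y R) :
    truncatedGenerator G μ d α R v (pointIndicator y) z =
      v z y / (G.dist z y : ℝ) ^ (d + α) * μ y -
        pointIndicator y z * ∑ u ∈ ballFinset h z R, v z u / (G.dist z u : ℝ) ^ (d + α) * μ u := by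
  rw [truncatedGenerator_eq_sum h, Finset.mul_sum]
  have e : v z y / (G.dist z y : ℝ) ^ (d + α) * μ y = ∑ u ∈ ballFinset h z R,
      pointIndicator y u * (v z u / (G.dist z u : ℝ) ^ (d + α) * μ u) := by
    rw [Finset.sum_eq_single y (fun u _ hu => by rw [pointIndicator_of_ne hu, zero_mul])
      (fun hy => absurd ((mem_ballFinset_comm h).1 hz) hy), pointIndicator_self, one_mul]
  rw [e, ← Finset.sum_sub_distrib]
  exact Finset.sum_congr rfl fun u _ => by ring

/-- The density of a truncated jump process is a heat flow. -/
lemma IsJumpProcess.heatFlow (h : IsDSetGraph G μ d cM cG rG) (hcM : 1 ≤ cM) (hdα : 0 < d + α)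
    (hR : 0 ≤ R) (hvs : ∀ y z, v y z = v z y) (hv : ∀ y z, 0 ≤ v y z) {D : ℝ}
    (hD : ∀ y, ∑ z ∈ ballFinset h y R, v y z / (G.dist y z : ℝ) ^ (d + α) *
        (G.dist y z : ℝ) ^ 2 * μ z ≤ D)
    {x : V} {Ω : Type*} {mΩ : MeasurableSpace Ω} {P : Measure Ω} [IsProbabilityMeasure P]
    {𝓕 : Filtration NNReal mΩ} {X : NNReal → Ω → V}
    (hX : IsJumpProcess (truncatedGenerator G μ d α R v) x P 𝓕 X) :
    HeatFlow μ (edgeWeight G μ d α R v) cM D x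
      (fun t y => P.real {ω | X t.toNNReal ω = y} / μ y) := by
  have hμ := h.mass_pos hcM
  have hm : ∀ t y, MeasurableSet {ω | X t ω = y} := fun t y => 𝓕.le t _ (hX.adapted t y)
  have hF : ∀ y, ∀ z ∉ ballFinset h y R,
      truncatedGenerator G μ d α R v (pointIndicator y) z = 0 := fun y z hz =>
    truncatedGenerator_pointIndicator_of_notMem h hR hz
  have hcount := h.countable x
  refine
    { c_pos := by linarith
      inv_le := h.le_mass_point
      k_symm := edgeWeight_symm hvs
      k_nonneg := edgeWeight_nonneg hμ hv
      k_summable := fun y => by simpa using summable_edgeWeight_mul h y fun _ => 1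
      k_tsum_le := tsum_edgeWeight_le h hcM hdα hv hD
      nonneg := fun t _ y => div_nonneg measureReal_nonneg (hμ y).le
      hasSum := ?_
      cont := fun y => (hX.continuousOn_prob (hF y)).div_const _
      deriv := ?_
      initial := ?_ }
  · intro t _
    have hs : ∀ F : Finset V, ∑ y ∈ F, P.real {ω | X t.toNNReal ω = y} ≤ 1 := fun F => by
      rw [← measureReal_biUnion_finset (fun a _ b _ hab => ?_) fun y _ => hm _ y]
      · exact measureReal_le_one
      · exact Set.disjoint_left.2 fun ω (ha : _ = a) (hb : _ = b) => hab (ha.symm.trans hb)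
    have h1 := (integrable_comp_and_hasSum (P := P) (hm t.toNNReal) (g := fun _ => (1 : ℝ))
      (by simpa using summable_of_sum_le (fun _ => measureReal_nonneg) hs)).2
    simp only [mul_one, integral_const, probReal_univ, smul_eq_mul] at h1
    refine h1.congr_fun ?_
    intro y
    have := (hμ y).ne'
    field_simp
  · intro y t ht
    refine ((hX.hasDerivAt_prob hF y ht).div_const (μ y)).congr_deriv ?_
    rw [tsum_edgeWeight_mul h, ← mul_assoc, inv_mul_cancel₀ (hμ y).ne', one_mul,
      div_eq_iff (hμ y).ne', Finset.sum_mul]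
    have e1 : ∀ u ∈ ballFinset h y R, truncatedGenerator G μ d α R v (pointIndicator y) u *
        P.real {ω | X t.toNNReal ω = u} =
        v y u / (G.dist y u : ℝ) ^ (d + α) * μ y * P.real {ω | X t.toNNReal ω = u} -
        pointIndicator y u * ((∑ z ∈ ballFinset h u R, v u z / (G.dist u z : ℝ) ^ (d + α) * μ z) *
          P.real {ω | X t.toNNReal ω = u}) := fun u hu => by
      rw [truncatedGenerator_pointIndicator h hu, hvs u y, SimpleGraph.dist_comm (u := u) (v := y)]
      ring
    rw [Finset.sum_congr rfl e1, Finset.sum_sub_distrib, Finset.sum_eq_single (a := y)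
      (f := fun u => pointIndicator y u * _)
      (fun u _ hu => by rw [pointIndicator_of_ne hu, zero_mul])
      (fun hy => absurd (self_mem_ballFinset h hR y) hy), pointIndicator_self, one_mul,
      Finset.sum_mul, ← Finset.sum_sub_distrib]
    refine Finset.sum_congr rfl fun u _ => ?_
    have h1 := (hμ y).ne'
    have h2 := (hμ u).ne'
    generalize v y u / (G.dist y u : ℝ) ^ (d + α) = a
    field_simp
  · intro y hy
    have : P.real {ω | X 0 ω = y} = 0 := by
      rw [measureReal_def]
      have h0 : P {ω | X 0 ω = y} = 0 := by
        refine measure_mono_null (fun ω hω => ?_) (ae_iff.1 hX.initial)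
        intro h'
        exact hy ((show X 0 ω = y from hω).symm.trans h')
      rw [h0]; rfl
    simp [this]

end Density

/-! ### Choice of parameters and conclusion. -/

lemma diffusive_bound {R t α d b D₁ cG k C M : ℝ} {n : ℕ} (hd : 0 < d) (hα : 0 < α) (hα2 : α < 2)
    (hb : 0 < b) (hD₁ : 0 < D₁) (hcG : 0 < cG) (hk : 0 < k) (hR : 1 ≤ R) (ht1 : 1 ≤ t)
    (htR : t ≤ R ^ α) (hM : 0 ≤ M)
    (hn1 : R ^ (1 - α / 2) * √t ≤ 6 * n) (hn2 : (n : ℝ) ≤ 2 * (R ^ (1 - α / 2) * √t))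
    (h : M ≤ 6 * b / R ^ (1 - α / 2) * (2 * (D₁ * R ^ (2 - α))) * √t +
      √t / (2 * (6 * b / R ^ (1 - α / 2))) *
        (b / n * M + d * Real.log n + 2 * cG - d / α * Real.log t + 2 * k + Real.log C + 2)) :
    M ≤ (24 * b * D₁ + 1 / (6 * b) *
      (d * Real.log 2 + 2 * cG + 2 * k + |Real.log C| + 2 + d * (1 / α - 1 / 2))) * R *
        (t / R ^ α) ^ (1 / 2 : ℝ) * (1 + Real.log (R ^ α / t)) := by
  have hR0 : 0 < R := by linarith
  have ht0 : 0 < t := by linarith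
  have hσ : 0 < R ^ (1 - α / 2) := by positivity
  have hst : 0 < √t := Real.sqrt_pos.2 ht0
  have hσ2 : R ^ (2 - α) = R ^ (1 - α / 2) * R ^ (1 - α / 2) := by
    rw [← Real.rpow_add hR0]; congr 1; ring
  have hS0 : R * (t / R ^ α) ^ (1 / 2 : ℝ) = R ^ (1 - α / 2) * √t := by
    rw [Real.div_rpow ht0.le (by positivity), ← Real.rpow_mul hR0.le, Real.sqrt_eq_rpow,
      Real.rpow_sub hR0, Real.rpow_one, show α * (1 / 2) = α / 2 by ring]
    ring
  rw [mul_assoc _ R, hS0]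
  have hlogS : Real.log (R ^ (1 - α / 2) * √t) =
      (1 - α / 2) * Real.log R + 1 / 2 * Real.log t := by
    rw [Real.log_mul hσ.ne' hst.ne', Real.log_rpow hR0, Real.log_sqrt ht0.le]; ring
  have hℓ : Real.log (R ^ α / t) = α * Real.log R - Real.log t := by
    rw [Real.log_div (by positivity) ht0.ne', Real.log_rpow hR0]
  have hℓ0 : 0 ≤ Real.log (R ^ α / t) := Real.log_nonneg ((one_le_div ht0).2 htR)
  set ℓ := Real.log (R ^ α / t)
  set S := R ^ (1 - α / 2) * √t with hS
  have hSpos : 0 < S := by positivity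
  have hnpos : (0 : ℝ) < n := by linarith
  have hlogn : Real.log n ≤ Real.log 2 + Real.log S := by
    rw [← Real.log_mul (by norm_num) hSpos.ne']
    exact Real.log_le_log hnpos hn2
  have e1 : 6 * b / R ^ (1 - α / 2) * (2 * (D₁ * R ^ (2 - α))) * √t = 12 * b * D₁ * S := by
    rw [hσ2, hS]; field_simp; ring
  have e2 : √t / (2 * (6 * b / R ^ (1 - α / 2))) = S / (12 * b) := by
    rw [hS]; field_simp; ring
  rw [e1, e2] at h
  -- The self-referential term is absorbed here: `S ≤ 6 n` makes its coefficient at most one half.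
  have e3 : S / (12 * b) * (b / n * M) ≤ M / 2 := by
    have e : S / (12 * b) * (b / n * M) = S / n * (M / 12) := by field_simp
    have h1 : S / n ≤ 6 := by rwa [div_le_iff₀ hnpos]
    rw [e]
    have := mul_le_mul_of_nonneg_right h1 (show 0 ≤ M / 12 by linarith)
    linarith
  -- The source of the logarithm: with `n` comparable to `S`, the difference is a multiple of `log
  -- (R ^ α / t)` up to a constant.
  have e4 : d * Real.log n - d / α * Real.log t ≤ d * Real.log 2 + d * (1 / α - 1 / 2) * ℓ := by
    have h1 := mul_le_mul_of_nonneg_left hlogn hd.le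
    rw [hlogS] at h1
    have h2 : d * (1 / α - 1 / 2) * ℓ =
        d * ((1 - α / 2) * Real.log R + 1 / 2 * Real.log t) - d / α * Real.log t := by
      rw [hℓ]; field_simp; ring
    linarith
  have hγ : 0 ≤ d * (1 / α - 1 / 2) := by
    refine mul_nonneg hd.le (sub_nonneg.2 ?_)
    exact one_div_le_one_div_of_le hα hα2.le
  set γ := d * (1 / α - 1 / 2)
  set Z := d * Real.log 2 + 2 * cG + 2 * k + |Real.log C| + 2 with hZ
  have hZ0 : 0 ≤ Z := by
    have := Real.log_nonneg (show (1 : ℝ) ≤ 2 by norm_num)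
    positivity
  have h5 : S / (12 * b) * (d * Real.log n + 2 * cG - d / α * Real.log t + 2 * k +
      Real.log C + 2) ≤ S / (12 * b) * (Z + γ * ℓ) :=
    mul_le_mul_of_nonneg_left (by linarith [le_abs_self (Real.log C)]) (by positivity)
  have h6 : M ≤ 24 * b * D₁ * S + S / (6 * b) * (Z + γ * ℓ) := by
    have e : S / (6 * b) * (Z + γ * ℓ) = 2 * (S / (12 * b) * (Z + γ * ℓ)) := by
      field_simp; ring
    rw [e]
    linarith
  refine h6.trans ?_
  have e5 : (24 * b * D₁ + 1 / (6 * b) * (Z + γ)) * S * (1 + ℓ) =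
      24 * b * D₁ * S + S / (6 * b) * (Z + γ * ℓ) + (24 * b * D₁ * S * ℓ +
        S / (6 * b) * (Z * ℓ + γ)) := by
    field_simp; ring
  rw [e5]
  have : 0 ≤ 24 * b * D₁ * S * ℓ + S / (6 * b) * (Z * ℓ + γ) := by positivity
  linarith

end StableLike

open StableLike MeasureTheory in
theorem mainTheorem10 (θ θ' : ℝ) (hθ : 0 < θ) (hθθ' : θ < θ') (hθ' : θ' < 1) :
    ∃ R₁ : ℝ → ℝ, (∀ R₀, 1 ≤ R₀ → R₀ < R₁ R₀) ∧
      ∀ d α cM cG C₁ C₂ : ℝ, 0 < d → 0 < α → α < 2 → 1 ≤ cM → 1 ≤ cG → 0 < C₁ → 0 < C₂ →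
        ∃ C₃ : ℝ, 0 < C₃ ∧
          ∀ (V : Type*) (G : SimpleGraph V) (μ : V → ℝ) (w : V → V → ℝ) (rG : EReal),
            StableLike.IsDSetGraph G μ d cM cG rG →
            StableLike.IsConductance G μ d α w →
            ∀ (x₀ : V) (R₀ : ℝ), 1 ≤ R₀ → (R₀ : EReal) < rG →
              (∀ R : ℝ, R₀ < R → (R : EReal) < rG → ∀ r : ℝ, R ^ θ ≤ r → r ≤ R →
                StableLike.ScaleBounds G μ d α w x₀ C₁ C₂ R r) →
              ∀ R : ℝ, R₁ R₀ < R → (R : EReal) < rG →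
                ∀ (x : V) (Ω : Type*) (mΩ : MeasurableSpace Ω)
                  (P : MeasureTheory.Measure Ω) (_ : MeasureTheory.IsProbabilityMeasure P)
                  (𝓕 : MeasureTheory.Filtration NNReal mΩ) (X : NNReal → Ω → V),
                  StableLike.IsJumpProcess
                    (StableLike.truncatedGenerator G μ d α R
                      (StableLike.localized G w x₀ R)) x P 𝓕 X →
                  ∀ t : NNReal, R ^ (θ' * α) ≤ (t : ℝ) → (t : ℝ) ≤ R ^ α →
                    MeasureTheory.Integrable (fun ω => (G.dist (X t ω) x : ℝ)) P ∧
                    ∫ ω, (G.dist (X t ω) x : ℝ) ∂P ≤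
                      C₃ * R * ((t : ℝ) / R ^ α) ^ (1 / 2 : ℝ) *
                        (1 + Real.log (R ^ α / (t : ℝ))) := by
  -- The `6` is for the volume scale `n = ⌈S / 6⌉` with `S ≤ R`: then `3 n ≤ R / 2 + 3 ≤ R`, which
  -- keeps `3 n` below `rG`.
  refine ⟨fun R₀ => R₀ + 6, fun R₀ _ => by linarith, ?_⟩
  intro d α cM cG C₁ C₂ hd hα hα2 hcM hcG hC₁ hC₂
  have hcM0 : 0 < cM := by linarith
  have hcG0 : 0 < cG := by linarith
  have hθ1 : θ < 1 := hθθ'.trans hθ'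
  set a := min C₂ cG⁻¹ with ha
  have ha0 : 0 < a := lt_min hC₂ (inv_pos.2 hcG0)
  set b := C₁ + cM * cG with hb
  have hb0 : 0 < b := by positivity
  -- The summand `α / d` only serves to make `A * (d / α)` at least one, as `decay_of_nash`
  -- requires.
  set A := max (cM * b / a ^ 2) (2 / a) + α / d with hA
  have hA1 : cM * b / a ^ 2 ≤ A := (le_max_left _ _).trans (le_add_of_nonneg_right (by positivity))
  have hA2 : 2 / a ≤ A := (le_max_right _ _).trans (le_add_of_nonneg_right (by positivity))
  have hA0 : 0 < A := lt_of_lt_of_le (by positivity) hA1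
  have hA3 : 1 ≤ A * (d / α) := by
    have h1 : α / d ≤ A := le_add_of_nonneg_left ((by positivity : (0 : ℝ) ≤ 2 / a).trans
      (le_max_right _ _))
    have h2 := mul_le_mul_of_nonneg_right h1 (show 0 ≤ d / α by positivity)
    refine le_trans (le_of_eq ?_) h2
    field_simp
  obtain ⟨C, hC, hdecay⟩ := decay_of_nash hd hα hθ hθθ' hcM0 hA0 hA3
  set m := θ * (d / α) / (θ' - θ) with hm
  have hm0 : 0 < m := div_pos (by positivity) (sub_pos.2 hθθ')
  have hq : (2 : ℝ) ^ (-(2 - α)) < 1 :=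
    Real.rpow_lt_one_of_one_lt_of_neg (by norm_num) (by linarith)
  set D₁ := cM * C₁ + 2 ^ (d + α) * cG / (1 - 2 ^ (-(2 - α))) with hD₁
  have hD₁0 : 0 < D₁ :=
    add_pos (by positivity) (div_pos (by positivity) (sub_pos.2 hq))
  set bΛ := Real.log (2 * (cG ^ 2 * 3 ^ d)) with hbΛ
  have hbΛ0 : 0 < bΛ := by
    refine Real.log_pos ?_
    have h1 : (1 : ℝ) ≤ 3 ^ d := Real.one_le_rpow (by norm_num) hd.le
    nlinarith [one_le_pow₀ hcG (n := 2)]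
  have hγ : 0 ≤ d * (1 / α - 1 / 2) :=
    mul_nonneg hd.le (sub_nonneg.2 (one_div_le_one_div_of_le hα hα2.le))
  have hlog2 : 0 ≤ Real.log 2 := Real.log_nonneg (by norm_num)
  refine ⟨24 * bΛ * D₁ + 1 / (6 * bΛ) * (d * Real.log 2 + 2 * cG + 2 * (d / α + m) +
    |Real.log C| + 2 + d * (1 / α - 1 / 2)), by positivity, ?_⟩
  intro V G μ w rG h hw x₀ R₀ hR₀ _ hS R hR hRG x Ω mΩ P hP 𝓕 X hX t ht htR
  have hR1 : 1 ≤ R := by linarith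
  have hR0 : 0 < R := by linarith
  have ht1 : 1 ≤ (t : ℝ) := (Real.one_le_rpow hR1 (by nlinarith)).trans ht
  have ht0 : 0 < (t : ℝ) := by linarith
  have hRθ : R ^ θ ≤ R := by
    simpa using Real.rpow_le_rpow_of_exponent_le hR1 hθ1.le
  have hS' := hS R (by linarith) hRG
  have hv := localized_nonneg (x₀ := x₀) (R := R) hw
  have hvs := localized_symm (x₀ := x₀) (R := R) hw
  have hD := second_moment_localized h hw hd hα hα2 hcM hcG hC₁ hR1 hRG (hS' R hRθ le_rfl)
  have hH := hX.heatFlow h hcM (by positivity) hR0.le hvs hv hD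
  set p : ℝ → V → ℝ := fun t y => P.real {ω | X t.toNNReal ω = y} / μ y with hp
  have hμ := h.mass_pos hcM
  have hE0 : ∀ s, 0 ≤ ∑' q : V × V, edgeWeight G μ d α R (localized G w x₀ R) q.1 q.2 *
      (p s q.1 - p s q.2) ^ 2 := fun s =>
    tsum_nonneg fun q => mul_nonneg (hH.k_nonneg _ _) (sq_nonneg _)
  have hnash : ∀ s, 0 < s → ∀ r, R ^ θ ≤ r → r ≤ R →
      ∑' y, μ y * (p s y * p s y) ≤ A * r ^ α * ∑' q : V × V,
        edgeWeight G μ d α R (localized G w x₀ R) q.1 q.2 * (p s q.1 - p s q.2) ^ 2 +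
        A * r ^ (-d) := by
    intro s hs r hr1 hr2
    have hr : 1 ≤ r := (Real.one_le_rpow hR1 hθ.le).trans hr1
    have h1 := hH.nash_of_pointwise (a := cM * b / a ^ 2 * r ^ α) (b := 2 / a * r ^ (-d)) hs.le
      fun y => mul_sq_le_average h hcM (by positivity) (hv y) ha0 hr hr2
        (P := (finite_posBall h (localized G w x₀ R) y r).toFinset)
        (fun z hz => ((finite_posBall h (localized G w x₀ R) y r).mem_toFinset).1 hz)
        (mass_posBall_localized h hcM hr hr2 hRG (hS' r hr1 hr2) y)
        (inverse_sum_localized h hw hcM hC₁ hr hr2 hRG (hS' r hr1 hr2) y)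
        (hH.nonneg s hs.le)
        (sum_le_hasSum _ (fun z _ => hH.mul_nonneg' hs.le z) (hH.hasSum s hs.le))
    refine h1.trans (add_le_add ?_ ?_)
    · exact mul_le_mul_of_nonneg_right (mul_le_mul_of_nonneg_right hA1 (by positivity)) (hE0 s)
    · exact mul_le_mul_of_nonneg_right hA2 (by positivity)
  have hdec := hdecay R _ _ hR1 hH.continuousOn_tsum_sq (fun s hs => hH.tsum_sq_le hs)
    (fun s hs => hH.hasDerivAt_tsum_sq hs) hnash t ht htR
  set S := R ^ (1 - α / 2) * √(t : ℝ) with hSdef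
  have hS1 : 1 ≤ S := by
    have h1 : 1 ≤ R ^ (1 - α / 2) := Real.one_le_rpow hR1 (by linarith)
    have h2 : 1 ≤ √(t : ℝ) := Real.one_le_sqrt.2 ht1
    nlinarith
  have hSR : S ≤ R := by
    have h1 : √(t : ℝ) ≤ R ^ (α / 2) := by
      rw [Real.sqrt_le_left (by positivity), ← Real.rpow_natCast, ← Real.rpow_mul hR0.le]
      simpa using htR
    calc S ≤ R ^ (1 - α / 2) * R ^ (α / 2) := mul_le_mul_of_nonneg_left h1 (by positivity)
      _ = R := by rw [← Real.rpow_add hR0]; simp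
  set n := ⌈S / 6⌉₊ with hn
  have hn1 : 1 ≤ n := Nat.one_le_ceil_iff.2 (by linarith)
  have hnS : S / 6 ≤ n := Nat.le_ceil _
  have hnS' : (n : ℝ) < S / 6 + 1 := Nat.ceil_lt_add_one (by linarith)
  have hvol := exp_growth h hd hcM hcG x hn1 (EReal_lt_of_le (by linarith) hRG)
  have hD' : ∀ y, ∑' z, edgeWeight G μ d α R (localized G w x₀ R) y z *
      ((G.dist x y : ℝ) - G.dist x z) ^ 2 ≤ D₁ * R ^ (2 - α) * μ y :=
    sum_gradient_le h hcM hv hD x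
  have hmom := hH.moment_le (ρ := fun y => G.dist x y) SimpleGraph.dist_self
    (D := D₁ * R ^ (2 - α)) (by positivity) (fun N => summable_truncated_dist h x N)
    (fun y => summable_edgeWeight_mul h y fun z => ((G.dist x y : ℝ) - G.dist x z) ^ 2) hD'
    (by exact_mod_cast hn1) hvol.1 hvol.2 (κ := 6 * bΛ / R ^ (1 - α / 2)) hC ht0 (by positivity)
    (by positivity) hdec
  have hterm : ∀ y, μ y * ((G.dist x y : ℝ) * p t y) =
      P.real {ω | X t ω = y} * (G.dist y x : ℝ) := fun y => by
    have := (hμ y).ne'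
    rw [hp, SimpleGraph.dist_comm (u := y)]
    simp only [Real.toNNReal_coe]
    field_simp
  have hcount := h.countable x
  have hint := integrable_comp_and_hasSum (P := P) (Y := X t)
    (fun y => 𝓕.le t _ (hX.adapted t y)) (g := fun y => (G.dist y x : ℝ))
    (hmom.1.congr fun y => by rw [hterm, abs_of_nonneg (Nat.cast_nonneg _)])
  refine ⟨hint.1, ?_⟩
  have hmean : ∫ ω, (G.dist (X t ω) x : ℝ) ∂P = HeatFlow.mean μ p (fun y => G.dist x y) t := by
    rw [← hint.2.tsum_eq]
    exact (tsum_congr hterm).symm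
  rw [hmean]
  have hM0 : 0 ≤ HeatFlow.mean μ p (fun y => G.dist x y) t := by
    rw [← hmean]
    exact integral_nonneg fun ω => Nat.cast_nonneg _
  exact diffusive_bound (n := n) hd hα hα2 hbΛ0 hD₁0 hcG0 (by positivity) hR1 ht1 htR hM0
    (by linarith) (by linarith) hmom.2
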